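/- A *finite groupoid* is a groupoid with finitely many objects and finitely many morphisms. For a finite groupoid $\mathcal{G}$, let ${}^{\mathcal{G}}\mathrm{Fin}$ be the category obtained from $\mathcal{G}$ by freely adjoining finite coproducts: its objects are finite families $(X_i)_{i\in I}$ of objects of $\mathcal{G}$, and a morphism $(X_i)_{i\in I}\to(Y_j)_{j\in J}$ is a map $f:I\to J$ together with morphisms $X_i\to Y_{f(i)}$ in $\mathcal{G}$. Let $\mathrm{Cat}_{\mathrm{pce}}$ be the 2-category whose objects are the categories with pullbacks and finite coproducts, whose 1-morphisms are the functors preserving pullbacks, finite coproducts and epimorphisms, and whose 2-morphisms are all natural transformations. A functor $p:\mathcal{K}\to\mathcal{G}$ of groupoids is a *discrete fibration* if for every object $X'$ of $\mathcal{K}$ and every morphism $f:p(X')\to Y$ of $\mathcal{G}$ there is a unique morphism $f':X'\to Y'$ of $\mathcal{K}$ with $p(f')=f$. Let $\mathrm{Burn}_{\mathrm{glo}}^{\mathrm{eff}}$ be the 2-category whose objects are the finite groupoids, whose 1-morphisms $\mathcal{G}\to\mathcal{H}$ are the spans $\mathcal{G}\xleftarrow{l}\mathcal{K}\xrightarrow{r}\mathcal{H}$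 of finite groupoids in which $l$ is a discrete fibration, with composition given by pullback. A 2-morphism from $(\mathcal{K},l,r)$ to $(\mathcal{K}',l',r')$ is an isomorphism class of span maps, that is, of triples $(m,\lambda,\rho)$ with $m:\mathcal{K}\to\mathcal{K}'$ a functor and $\lambda:l\cong l'm$, $\rho:r\cong r'm$ natural isomorphisms; $(m,\lambda,\rho)$ and $(n,\lambda',\rho')$ are isomorphic if there is a natural isomorphism $\theta:m\cong n$ with $l'\theta\circ\lambda=\lambda'$ and $r'\theta\circ\rho=\rho'$. **Theorem.** The full sub-2-category of $\mathrm{Cat}_{\mathrm{pce}}$ spanned by the categories ${}^{\mathcal{G}}\mathrm{Fin}$, for $\mathcal{G}$ ranging over finite groupoids, is equivalent to $\mathrm{Burn}_{\mathrm{glo}}^{\mathrm{eff}}$. More precisely, there is a pseudofunctor from $\mathrm{Burn}_{\mathrm{glo}}^{\mathrm{eff}}$ to this full sub-2-category which sends each finite groupoid $\mathcal{G}$ to ${}^{\mathcal{G}}\mathrm{Fin}$, is essentially surjective on objects up to equivalence, and induces an equivalence of categories of 1-morphisms between any two objects. The same holds for the $(2,1)$-categories obtained from these two 2-categories by discarding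 the noninvertible 2-morphisms. -/

import Mathlib

open CategoryTheory CategoryTheory.Limits

universe w v u

set_option linter.unusedVariables false

namespace GlobalBurnside

noncomputable section

section SpanMap

theorem comp_map_id {C D : Type u} [Groupoid.{u} C] [Groupoid.{u} D] (F : C ⥤ D) {x : C} {y : D}
    (a : y ⟶ F.obj x) : a ≫ F.map (𝟙 x) = a := by simp

theorem comp_id_eq_id_comp {C : Type u} [Groupoid.{u} C] {x y : C} (f : x ⟶ y) :
    f ≫ 𝟙 y = 𝟙 x ≫ f := by simp

theorem id_comp_comp_map_id {C D : Type u} [Groupoid.{u} C] [Groupoid.{u} D] (F : C ⥤ D) {x : C} {y : D}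
    (a : y ⟶ F.obj x) : (𝟙 y ≫ a) ≫ F.map (𝟙 x) = a := by simp

theorem id_comp_comp_map_id' {C D : Type u} [Groupoid.{u} C] [Groupoid.{u} D] (F : C ⥤ D) {x : C} {y : D}
    (a : y ⟶ F.obj x) : (𝟙 y ≫ a) ≫ F.map (𝟙 x) = a ≫ 𝟙 _ := by simp

theorem comp_id_comp_map_id {C D : Type u} [Groupoid.{u} C] [Groupoid.{u} D] (F : C ⥤ D) {x : C} {y : D}
    (a : y ⟶ F.obj x) : (a ≫ 𝟙 _) ≫ F.map (𝟙 x) = a := by simp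

theorem comp_id_comp_map_id' {C D : Type u} [Groupoid.{u} C] [Groupoid.{u} D] (F : C ⥤ D) {x : C} {y : D}
    (a : y ⟶ F.obj x) : (a ≫ 𝟙 _) ≫ F.map (𝟙 x) = 𝟙 _ ≫ a := by simp

variable {G H M N K K' K'' K''' L L' L'' P P' : Type u}
  [Groupoid.{u} G] [Groupoid.{u} H] [Groupoid.{u} M] [Groupoid.{u} N]
  [Groupoid.{u} K] [Groupoid.{u} K'] [Groupoid.{u} K''] [Groupoid.{u} K''']
  [Groupoid.{u} L] [Groupoid.{u} L'] [Groupoid.{u} L''] [Groupoid.{u} P] [Groupoid.{u} P']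

/-- A map from the span `G ← K ⟶ H` with legs `l`, `r` to the span `G ← K' ⟶ H` with legs `l'`,
`r'`: a functor `K ⥤ K'` with natural isomorphisms (all morphisms of `G` and `H` are invertible)
between the left legs and between the right legs. -/
structure SpanMap (l : K ⥤ G) (r : K ⥤ H) (l' : K' ⥤ G) (r' : K' ⥤ H) : Type u where
  functor : K ⥤ K'
  left (k : K) : l.obj k ⟶ l'.obj (functor.obj k)
  right (k : K) : r.obj k ⟶ r'.obj (functor.obj k)
  left_naturality {k₁ k₂ : K} (f : k₁ ⟶ k₂) :
    l.map f ≫ left k₂ = left k₁ ≫ l'.map (functor.map f) := by cat_disch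
  right_naturality {k₁ k₂ : K} (f : k₁ ⟶ k₂) :
    r.map f ≫ right k₂ = right k₁ ≫ r'.map (functor.map f) := by cat_disch

theorem SpanMap.left_naturality_assoc {l : K ⥤ G} {r : K ⥤ H} {l' : K' ⥤ G} {r' : K' ⥤ H}
    (m : SpanMap l r l' r') {k₁ k₂ : K} (f : k₁ ⟶ k₂) {x : G}
    (g : l'.obj (m.functor.obj k₂) ⟶ x) :
    l.map f ≫ m.left k₂ ≫ g = m.left k₁ ≫ l'.map (m.functor.map f) ≫ g := by
  rw [← Category.assoc, m.left_naturality, Category.assoc]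

theorem SpanMap.right_naturality_assoc {l : K ⥤ G} {r : K ⥤ H} {l' : K' ⥤ G} {r' : K' ⥤ H}
    (m : SpanMap l r l' r') {k₁ k₂ : K} (f : k₁ ⟶ k₂) {x : H}
    (g : r'.obj (m.functor.obj k₂) ⟶ x) :
    r.map f ≫ m.right k₂ ≫ g = m.right k₁ ≫ r'.map (m.functor.map f) ≫ g := by
  rw [← Category.assoc, m.right_naturality, Category.assoc]

namespace SpanMap

variable {l : K ⥤ G} {r : K ⥤ H} {l' : K' ⥤ G} {r' : K' ⥤ H}
  {l'' : K'' ⥤ G} {r'' : K'' ⥤ H} {l''' : K''' ⥤ G} {r''' : K''' ⥤ H}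

/-- Two span maps are identified if there is a natural isomorphism of the underlying functors which is
compatible with the isomorphisms between the legs. -/
def Rel (m n : SpanMap l r l' r') : Prop :=
  ∃ θ : m.functor ⟶ n.functor,
    (∀ k, m.left k ≫ l'.map (θ.app k) = n.left k) ∧
    (∀ k, m.right k ≫ r'.map (θ.app k) = n.right k)

theorem rel_equivalence : Equivalence (Rel (l := l) (r := r) (l' := l') (r' := r')) where
  refl m := ⟨𝟙 _, fun k => by simp, fun k => by simp⟩
  symm := by
    rintro m n ⟨θ, h₁, h₂⟩
    refine ⟨{ app k := inv (θ.app k) }, fun k => ?_, fun k => ?_⟩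
    · rw [← h₁]; simp
    · rw [← h₂]; simp
  trans := by
    rintro m n p ⟨θ, h₁, h₂⟩ ⟨θ', h₁', h₂'⟩
    refine ⟨θ ≫ θ', fun k => ?_, fun k => ?_⟩
    · rw [← h₁', ← h₁]; simp
    · rw [← h₂', ← h₂]; simp

variable (l r) in
abbrev id : SpanMap l r l r where
  functor := 𝟭 _
  left k := 𝟙 _
  right k := 𝟙 _

abbrev comp (m : SpanMap l r l' r') (n : SpanMap l' r' l'' r'') : SpanMap l r l'' r'' where
  functor := m.functor ⋙ n.functor
  left k := m.left k ≫ n.left (m.functor.obj k)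
  right k := m.right k ≫ n.right (m.functor.obj k)
  left_naturality f := by
    simp [m.left_naturality_assoc, n.left_naturality]
  right_naturality f := by
    simp [m.right_naturality_assoc, n.right_naturality]

theorem comp_rel {m m' : SpanMap l r l' r'} (h : m.Rel m')
    {n n' : SpanMap l' r' l'' r''} (h' : n.Rel n') : (m.comp n).Rel (m'.comp n') := by
  obtain ⟨θ, h₁, h₂⟩ := h
  obtain ⟨ζ, h₁', h₂'⟩ := h'
  refine ⟨{ app k := ζ.app (m.functor.obj k) ≫ n'.functor.map (θ.app k)
            naturality k k' f := ?_ }, fun k => ?_, fun k => ?_⟩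
  · simp only [Functor.comp_map, Category.assoc, NatTrans.naturality_assoc,
      ← Functor.map_comp, θ.naturality]
  · have := congrArg (l''.map ·) (ζ.naturality (θ.app k))
    simp only [Functor.map_comp] at this
    simp [← h₁, ← h₁', n.left_naturality_assoc, this]
  · have := congrArg (r''.map ·) (ζ.naturality (θ.app k))
    simp only [Functor.map_comp] at this
    simp [← h₂, ← h₂', n.right_naturality_assoc, this]

theorem id_comp_rel (m : SpanMap l r l' r') : ((id l r).comp m).Rel m :=
  ⟨{ app k := 𝟙 _ }, fun k => by simp, fun k => by simp⟩

theorem comp_id_rel (m : SpanMap l r l' r') : (m.comp (id l' r')).Rel m :=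
  ⟨{ app k := 𝟙 _ }, fun k => by simp, fun k => by simp⟩

theorem assoc_rel (m : SpanMap l r l' r') (n : SpanMap l' r' l'' r'')
    (p : SpanMap l'' r'' l''' r''') : ((m.comp n).comp p).Rel (m.comp (n.comp p)) :=
  ⟨{ app k := 𝟙 _ }, fun k => by simp, fun k => by simp⟩

instance commaGroupoid (p : K ⥤ H) (q : L ⥤ H) : Groupoid.{u} (Comma p q) where
  inv f :=
    { left := Groupoid.inv f.left
      right := Groupoid.inv f.right
      w := by simp [Groupoid.inv_eq_inv] }
  inv_comp f := by ext <;> simp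
  comp_inv f := by ext <;> simp

/-- The left leg of the composite of two spans by homotopy pullback. The comma category of `r` and
`p` has as objects triples `(k, l, r k ≅ p l)`, so it is their homotopy pullback. -/
abbrev fstLeg (l : K ⥤ G) (r : K ⥤ H) (p : L ⥤ H) : Comma r p ⥤ G := Comma.fst r p ⋙ l

/-- The right leg of the composite of two spans by homotopy pullback. -/
abbrev sndLeg (r : K ⥤ H) (p : L ⥤ H) (q : L ⥤ M) : Comma r p ⥤ M := Comma.snd r p ⋙ q

variable {p : L ⥤ H} {q : L ⥤ M} {p' : L' ⥤ H} {q' : L' ⥤ M} {p'' : L'' ⥤ H} {q'' : L'' ⥤ M}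

variable (l r) in
abbrev whiskerLeft (m : SpanMap p q p' q') :
    SpanMap (fstLeg l r p) (sndLeg r p q) (fstLeg l r p') (sndLeg r p' q') where
  functor :=
    { obj x := ⟨x.left, m.functor.obj x.right, x.hom ≫ m.left x.right⟩
      map f :=
        { left := f.left
          right := m.functor.map f.right
          w := by simp [← m.left_naturality] } }
  left x := 𝟙 (l.obj x.left)
  right x := m.right x.right
  left_naturality f := comp_id_eq_id_comp _
  right_naturality f := m.right_naturality f.right

variable (p q) in
abbrev whiskerRight (m : SpanMap l r l' r') :
    SpanMap (fstLeg l r p) (sndLeg r p q) (fstLeg l' r' p) (sndLeg r' p q) where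
  functor :=
    { obj x := ⟨m.functor.obj x.left, x.right, inv (m.right x.left) ≫ x.hom⟩
      map f :=
        { left := m.functor.map f.left
          right := f.right
          w := by simp [← m.right_naturality_assoc, ← cancel_epi (m.right _)] } }
  left x := m.left x.left
  right x := 𝟙 (q.obj x.right)
  left_naturality f := m.left_naturality f.left
  right_naturality f := comp_id_eq_id_comp _
theorem whiskerLeft_rel {m n : SpanMap p q p' q'} (h : m.Rel n) :
    (whiskerLeft l r m).Rel (whiskerLeft l r n) := by
  obtain ⟨θ, h₁, h₂⟩ := h
  exact ⟨{ app x := { left := 𝟙 _, right := θ.app x.right, w := by simp [← h₁] } },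
    fun x => comp_map_id l _, fun x => h₂ x.right⟩

theorem whiskerRight_rel {m n : SpanMap l r l' r'} (h : m.Rel n) :
    (whiskerRight p q m).Rel (whiskerRight p q n) := by
  obtain ⟨θ, h₁, h₂⟩ := h
  exact ⟨{ app x := { left := θ.app x.left, right := 𝟙 _, w := by simp [← h₂] } },
    fun x => h₁ x.left, fun x => comp_map_id q _⟩

theorem whiskerLeft_id_rel : (whiskerLeft l r (id p q)).Rel (id (fstLeg l r p) (sndLeg r p q)) :=
  ⟨{ app x := { left := 𝟙 x.left, right := 𝟙 x.right } },
    fun x => comp_map_id l _, fun x => comp_map_id q _⟩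

theorem id_whiskerRight_rel :
    (whiskerRight p q (id l r)).Rel (id (fstLeg l r p) (sndLeg r p q)) :=
  ⟨{ app x := { left := 𝟙 x.left, right := 𝟙 x.right } },
    fun x => comp_map_id l _, fun x => comp_map_id q _⟩

theorem whiskerLeft_comp_rel (m : SpanMap p q p' q') (n : SpanMap p' q' p'' q'') :
    (whiskerLeft l r (m.comp n)).Rel ((whiskerLeft l r m).comp (whiskerLeft l r n)) :=
  ⟨{ app x := { left := 𝟙 x.left, right := 𝟙 _ } },
    fun x => (comp_map_id l _).trans (Category.comp_id (𝟙 _)).symm, fun x => comp_map_id q'' _⟩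

theorem comp_whiskerRight_rel (m : SpanMap l r l' r') (n : SpanMap l' r' l'' r'') :
    (whiskerRight p q (m.comp n)).Rel ((whiskerRight p q m).comp (whiskerRight p q n)) :=
  ⟨{ app x := { left := 𝟙 _, right := 𝟙 x.right } },
    fun x => comp_map_id l'' _, fun x => (comp_map_id q _).trans (Category.comp_id (𝟙 _)).symm⟩

theorem whisker_exchange_rel (m : SpanMap l r l' r') (n : SpanMap p q p' q') :
    ((whiskerLeft l r n).comp (whiskerRight p' q' m)).Rel
      ((whiskerRight p q m).comp (whiskerLeft l' r' n)) :=
  ⟨{ app x := { left := 𝟙 _, right := 𝟙 _ } },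
    fun x => id_comp_comp_map_id' l' _, fun x => comp_id_comp_map_id' q' _⟩

variable (l r) in
abbrev leftUnitor : SpanMap (fstLeg (𝟭 G) (𝟭 G) l) (sndLeg (𝟭 G) l r) l r where
  functor := Comma.snd (𝟭 G) l
  left x := x.hom
  right x := 𝟙 (r.obj x.right)
  left_naturality f := f.w
  right_naturality f := comp_id_eq_id_comp _

variable (l r) in
abbrev leftUnitorInv : SpanMap l r (fstLeg (𝟭 G) (𝟭 G) l) (sndLeg (𝟭 G) l r) where
  functor :=
    { obj k := ⟨l.obj k, k, 𝟙 (l.obj k)⟩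
      map f := { left := l.map f, right := f } }
  left k := 𝟙 (l.obj k)
  right k := 𝟙 (r.obj k)

theorem leftUnitor_hom_inv : ((leftUnitor l r).comp (leftUnitorInv l r)).Rel (id _ _) :=
  ⟨{ app x :=
      { left := inv x.hom
        right := 𝟙 x.right
        w := (IsIso.inv_hom_id x.hom).trans (comp_map_id l (𝟙 _)).symm }
     naturality x y f := by
      ext
      · show l.map f.right ≫ inv y.hom = inv x.hom ≫ f.left
        rw [IsIso.comp_inv_eq, Category.assoc, IsIso.eq_inv_comp]
        exact f.w.symm
      · exact comp_id_eq_id_comp f.right },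
    fun x => by simp, fun x => comp_id_comp_map_id r _⟩

theorem leftUnitor_inv_hom : ((leftUnitorInv l r).comp (leftUnitor l r)).Rel (id _ _) :=
  ⟨{ app x := 𝟙 x, naturality _ _ f := comp_id_eq_id_comp f },
    fun x => id_comp_comp_map_id l _, fun x => id_comp_comp_map_id r _⟩

variable (l r) in
abbrev rightUnitor : SpanMap (fstLeg l r (𝟭 H)) (sndLeg r (𝟭 H) (𝟭 H)) l r where
  functor := Comma.fst r (𝟭 H)
  left x := 𝟙 (l.obj x.left)
  right x := inv x.hom
  left_naturality f := comp_id_eq_id_comp _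
  right_naturality f := by
    rw [IsIso.comp_inv_eq, Category.assoc]
    exact (IsIso.eq_inv_comp _).2 f.w.symm

variable (l r) in
abbrev rightUnitorInv : SpanMap l r (fstLeg l r (𝟭 H)) (sndLeg r (𝟭 H) (𝟭 H)) where
  functor :=
    { obj k := ⟨k, r.obj k, 𝟙 (r.obj k)⟩
      map f := { left := f, right := r.map f } }
  left k := 𝟙 (l.obj k)
  right k := 𝟙 (r.obj k)

theorem rightUnitor_hom_inv : ((rightUnitor l r).comp (rightUnitorInv l r)).Rel (id _ _) :=
  ⟨{ app x :=
      { left := 𝟙 x.left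
        right := x.hom
        w := (show r.map (𝟙 x.left) ≫ x.hom = 𝟙 _ ≫ x.hom by simp) }
     naturality x y f := by
      ext
      · exact comp_id_eq_id_comp f.left
      · exact f.w },
    fun x => comp_id_comp_map_id l _,
    fun x => (show (inv x.hom ≫ 𝟙 _) ≫ x.hom = 𝟙 _ by simp)⟩

theorem rightUnitor_inv_hom : ((rightUnitorInv l r).comp (rightUnitor l r)).Rel (id _ _) :=
  ⟨{ app x := 𝟙 x, naturality _ _ f := comp_id_eq_id_comp f },
    fun x => id_comp_comp_map_id l _,
    fun x => (show (𝟙 _ ≫ inv (𝟙 (r.obj x))) ≫ r.map (𝟙 x) = 𝟙 _ by simp)⟩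

variable {s : P ⥤ M} {t : P ⥤ N}

variable (l r p q s t) in
abbrev associator :
    SpanMap (fstLeg (fstLeg l r p) (sndLeg r p q) s) (sndLeg (sndLeg r p q) s t)
      (fstLeg l r (fstLeg p q s)) (sndLeg r (fstLeg p q s) (sndLeg q s t)) where
  functor :=
    { obj x := ⟨x.left.left, ⟨x.left.right, x.right, x.hom⟩, x.left.hom⟩
      map f :=
        { left := f.left.left
          right := { left := f.left.right, right := f.right, w := f.w }
          w := f.left.w } }
  left x := 𝟙 (l.obj x.left.left)
  right x := 𝟙 (t.obj x.right)
  left_naturality f := comp_id_eq_id_comp _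
  right_naturality f := comp_id_eq_id_comp _

variable (l r p q s t) in
abbrev associatorInv :
    SpanMap (fstLeg l r (fstLeg p q s)) (sndLeg r (fstLeg p q s) (sndLeg q s t))
      (fstLeg (fstLeg l r p) (sndLeg r p q) s) (sndLeg (sndLeg r p q) s t) where
  functor :=
    { obj x := ⟨⟨x.left, x.right.left, x.hom⟩, x.right.right, x.right.hom⟩
      map f :=
        { left := { left := f.left, right := f.right.left, w := f.w }
          right := f.right.right
          w := f.right.w } }
  left x := 𝟙 (l.obj x.left)
  right x := 𝟙 (t.obj x.right.right)
  left_naturality f := comp_id_eq_id_comp _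
  right_naturality f := comp_id_eq_id_comp _

theorem associator_hom_inv :
    ((associator l r p q s t).comp (associatorInv l r p q s t)).Rel (id _ _) :=
  ⟨{ app x := 𝟙 x, naturality _ _ f := comp_id_eq_id_comp f },
    fun x => id_comp_comp_map_id l (𝟙 _), fun x => id_comp_comp_map_id t (𝟙 _)⟩

theorem associator_inv_hom :
    ((associatorInv l r p q s t).comp (associator l r p q s t)).Rel (id _ _) :=
  ⟨{ app x := 𝟙 x, naturality _ _ f := comp_id_eq_id_comp f },
    fun x => id_comp_comp_map_id l (𝟙 _), fun x => id_comp_comp_map_id t (𝟙 _)⟩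

theorem id_whiskerLeft_rel (m : SpanMap l r l' r') :
    ((whiskerLeft (𝟭 G) (𝟭 G) m).comp (leftUnitor l' r')).Rel ((leftUnitor l r).comp m) :=
  ⟨{ app x := 𝟙 (m.functor.obj x.right), naturality _ _ f := comp_id_eq_id_comp _ },
    fun x => id_comp_comp_map_id l' _, fun x => comp_id_comp_map_id' r' _⟩

theorem whiskerRight_id_rel (m : SpanMap l r l' r') :
    ((whiskerRight (𝟭 H) (𝟭 H) m).comp (rightUnitor l' r')).Rel ((rightUnitor l r).comp m) :=
  ⟨{ app x := 𝟙 (m.functor.obj x.left), naturality _ _ f := comp_id_eq_id_comp _ },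
    fun x => comp_id_comp_map_id' l' _,
    fun x => (show (𝟙 _ ≫ inv (inv (m.right x.left) ≫ x.hom)) ≫ r'.map (𝟙 _) =
      inv x.hom ≫ m.right x.left by simp)⟩

variable {s' : P' ⥤ M} {t' : P' ⥤ N}

theorem comp_whiskerLeft_rel (m : SpanMap s t s' t') :
    ((whiskerLeft (fstLeg l r p) (sndLeg r p q) m).comp (associator l r p q s' t')).Rel
      ((associator l r p q s t).comp (whiskerLeft l r (whiskerLeft p q m))) :=
  ⟨{ app x :=
      { left := 𝟙 x.left.left
        right := 𝟙 (((associator l r p q s t).comp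
          (whiskerLeft l r (whiskerLeft p q m))).functor.obj x).right
        w := (show r.map (𝟙 _) ≫ x.left.hom ≫ 𝟙 _ = x.left.hom ≫ p.map (𝟙 _) by simp) }
     naturality x y f := by
      ext
      · exact comp_id_eq_id_comp f.left.left
      · exact comp_id_eq_id_comp f.left.right
      · exact comp_id_eq_id_comp (m.functor.map f.right) },
    fun x => comp_map_id l (𝟙 _ ≫ 𝟙 _), fun x => comp_id_comp_map_id' t' _⟩

theorem whiskerRight_comp_rel (m : SpanMap l r l' r') :
    ((associator l r p q s t).comp (whiskerRight (fstLeg p q s) (sndLeg q s t) m)).Rel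
      ((whiskerRight s t (whiskerRight p q m)).comp (associator l' r' p q s t)) :=
  ⟨{ app x :=
      { left := 𝟙 (m.functor.obj x.left.left)
        right :=
          { left := 𝟙 x.left.right
            right := 𝟙 x.right
            w := (show q.map (𝟙 _) ≫ inv (𝟙 _) ≫ x.hom = x.hom ≫ s.map (𝟙 _) by simp) }
        w := (show r'.map (𝟙 _) ≫ inv (m.right x.left.left) ≫ x.left.hom =
          (inv (m.right x.left.left) ≫ x.left.hom) ≫ p.map (𝟙 _) by simp) }
     naturality x y f := by
      ext
      · exact comp_id_eq_id_comp (m.functor.map f.left.left)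
      · exact comp_id_eq_id_comp f.left.right
      · exact comp_id_eq_id_comp f.right },
    fun x => id_comp_comp_map_id' l' _, fun x => comp_map_id t (𝟙 _ ≫ 𝟙 _)⟩

theorem whisker_assoc_rel (m : SpanMap p q p' q') :
    ((whiskerRight s t (whiskerLeft l r m)).comp (associator l r p' q' s t)).Rel
      ((associator l r p q s t).comp (whiskerLeft l r (whiskerRight s t m))) :=
  ⟨{ app x := 𝟙 (((associator l r p q s t).comp
        (whiskerLeft l r (whiskerRight s t m))).functor.obj x)
     naturality _ _ f := comp_id_eq_id_comp _ },
    fun x => comp_map_id l (𝟙 _ ≫ 𝟙 _), fun x => comp_map_id t (𝟙 _ ≫ 𝟙 _)⟩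

theorem triangle_rel :
    ((associator l r (𝟭 H) (𝟭 H) p q).comp (whiskerLeft l r (leftUnitor p q))).Rel
      (whiskerRight p q (rightUnitor l r)) :=
  ⟨{ app x := { left := 𝟙 _, right := 𝟙 _ } },
    fun x => id_comp_comp_map_id l (𝟙 _), fun x => id_comp_comp_map_id q (𝟙 _)⟩

variable {Q : Type u} [Groupoid.{u} Q] {O : Type u} [Groupoid.{u} O] {a : Q ⥤ N} {b : Q ⥤ O}

theorem pentagon_rel :
    ((whiskerRight a b (associator l r p q s t)).comp
      ((associator l r (fstLeg p q s) (sndLeg q s t) a b).comp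
        (whiskerLeft l r (associator p q s t a b)))).Rel
      ((associator (fstLeg l r p) (sndLeg r p q) s t a b).comp
        (associator l r p q (fstLeg s t a) (sndLeg t a b))) :=
  ⟨{ app x :=
      { left := 𝟙 x.left.left.left
        right :=
          { left := 𝟙 x.left.left.right
            right :=
              { left := 𝟙 x.left.right
                right := 𝟙 x.right
                w := (show t.map (𝟙 _) ≫ x.hom = (inv (𝟙 _) ≫ x.hom) ≫ a.map (𝟙 _) by simp) }
            w := (show q.map (𝟙 _) ≫ x.left.hom = x.left.hom ≫ s.map (𝟙 _) by simp) }
        w := (show r.map (𝟙 _) ≫ x.left.left.hom =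
          (x.left.left.hom ≫ 𝟙 _) ≫ p.map (𝟙 _) by simp) }
     naturality x y f := by
      ext
      · exact comp_id_eq_id_comp f.left.left.left
      · exact comp_id_eq_id_comp f.left.left.right
      · exact comp_id_eq_id_comp f.left.right
      · exact comp_id_eq_id_comp f.right },
    fun x => (show (𝟙 _ ≫ 𝟙 _ ≫ 𝟙 _) ≫ l.map (𝟙 x.left.left.left) = 𝟙 _ ≫ 𝟙 _ by simp),
    fun x => (show (𝟙 _ ≫ 𝟙 _ ≫ 𝟙 _) ≫ b.map (𝟙 x.right) = 𝟙 _ ≫ 𝟙 _ by simp)⟩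

end SpanMap
end SpanMap

/-- Finite groupoids: finitely many objects and finitely many morphisms. -/
structure FinGpd : Type (u + 1) where
  carrier : Type u
  [groupoid : Groupoid.{u} carrier]
  [finite_obj : Finite carrier]
  [finite_hom : ∀ X Y : carrier, Finite (X ⟶ Y)]

instance : CoeSort FinGpd.{u} (Type u) := ⟨FinGpd.carrier⟩
attribute [instance] FinGpd.groupoid FinGpd.finite_obj FinGpd.finite_hom

instance commaFinite {H K L : FinGpd.{u}} (p : K ⥤ H) (q : L ⥤ H) : Finite (Comma p q) :=
  Finite.of_injective
    (fun x : Comma p q => (⟨x.left, x.right, x.hom⟩ : Σ (k : K) (l : L), p.obj k ⟶ q.obj l))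
    (by rintro ⟨⟩ ⟨⟩ h; simp at h; obtain ⟨rfl, h⟩ := h; simp at h; obtain ⟨rfl, h⟩ := h
        simp at h; subst h; rfl)

instance commaHomFinite {H K L : FinGpd.{u}} (p : K ⥤ H) (q : L ⥤ H) (x y : Comma p q) :
    Finite (x ⟶ y) :=
  Finite.of_injective (fun f => (f.left, f.right)) (by
    rintro f g h
    ext
    · exact congrArg Prod.fst h
    · exact congrArg Prod.snd h)

/-- Spans of finite groupoids. -/
structure GpdSpan (G H : FinGpd.{u}) : Type (u + 1) where
  apex : FinGpd.{u}
  left : apex ⥤ G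
  right : apex ⥤ H

namespace GpdSpan

variable {G H M N O : FinGpd.{u}}

abbrev Map (S T : GpdSpan G H) : Type u := SpanMap S.left S.right T.left T.right

instance mapSetoid (S T : GpdSpan G H) : Setoid (S.Map T) where
  r := SpanMap.Rel
  iseqv := SpanMap.rel_equivalence

/-- The category of spans from `G` to `H`: morphisms are isomorphism classes of span maps. -/
instance category : Category (GpdSpan G H) where
  Hom S T := Quotient (mapSetoid S T)
  id S := Quotient.mk _ (SpanMap.id S.left S.right)
  comp := Quotient.map₂ SpanMap.comp fun _ _ h _ _ h' => SpanMap.comp_rel h h'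
  id_comp := by
    rintro S T ⟨m⟩
    exact Quotient.sound (SpanMap.id_comp_rel m)
  comp_id := by
    rintro S T ⟨m⟩
    exact Quotient.sound (SpanMap.comp_id_rel m)
  assoc := by
    rintro S T U V ⟨m⟩ ⟨n⟩ ⟨p⟩
    exact Quotient.sound (SpanMap.assoc_rel m n p)

def Map.toHom {S T : GpdSpan G H} (m : S.Map T) : S ⟶ T := Quotient.mk _ m

theorem Map.toHom_surjective {S T : GpdSpan G H} (η : S ⟶ T) :
    ∃ m : S.Map T, Map.toHom m = η :=
  Quotient.exists_rep η

theorem Map.toHom_eq {S T : GpdSpan G H} {m n : S.Map T} (h : SpanMap.Rel m n) :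
    Map.toHom m = Map.toHom n := Quotient.sound h

def isoMk {S T : GpdSpan G H} (m : S.Map T) (n : T.Map S)
    (h : SpanMap.Rel (m.comp n) (SpanMap.id S.left S.right))
    (h' : SpanMap.Rel (n.comp m) (SpanMap.id T.left T.right)) : S ≅ T where
  hom := Map.toHom m
  inv := Map.toHom n
  hom_inv_id := Map.toHom_eq h
  inv_hom_id := Map.toHom_eq h'

abbrev identity (G : FinGpd.{u}) : GpdSpan G G := ⟨G, 𝟭 G, 𝟭 G⟩

/-- Composition of spans by homotopy pullback. -/
abbrev comp (S : GpdSpan G H) (T : GpdSpan H M) : GpdSpan G M where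
  apex := ⟨Comma S.right T.left⟩
  left := SpanMap.fstLeg S.left S.right T.left
  right := SpanMap.sndLeg S.right T.left T.right

def whiskerLeft (S : GpdSpan G H) {T T' : GpdSpan H M} (η : T ⟶ T') : S.comp T ⟶ S.comp T' :=
  Quotient.map (SpanMap.whiskerLeft S.left S.right) (fun _ _ h => SpanMap.whiskerLeft_rel h) η

def whiskerRight {S S' : GpdSpan G H} (η : S ⟶ S') (T : GpdSpan H M) : S.comp T ⟶ S'.comp T :=
  Quotient.map (SpanMap.whiskerRight T.left T.right) (fun _ _ h => SpanMap.whiskerRight_rel h) η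

def associator (S : GpdSpan G H) (T : GpdSpan H M) (U : GpdSpan M N) :
    (S.comp T).comp U ≅ S.comp (T.comp U) :=
  isoMk (SpanMap.associator S.left S.right T.left T.right U.left U.right)
    (SpanMap.associatorInv S.left S.right T.left T.right U.left U.right)
    SpanMap.associator_hom_inv SpanMap.associator_inv_hom

def leftUnitor (S : GpdSpan G H) : (identity G).comp S ≅ S :=
  isoMk (SpanMap.leftUnitor S.left S.right) (SpanMap.leftUnitorInv S.left S.right)
    SpanMap.leftUnitor_hom_inv SpanMap.leftUnitor_inv_hom

def rightUnitor (S : GpdSpan G H) : S.comp (identity H) ≅ S :=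
  isoMk (SpanMap.rightUnitor S.left S.right) (SpanMap.rightUnitorInv S.left S.right)
    SpanMap.rightUnitor_hom_inv SpanMap.rightUnitor_inv_hom

end GpdSpan

/-- Finite groupoids, as objects of the 2-category of all spans. -/
structure AllSpans : Type (u + 1) where
  of : FinGpd.{u}

open GpdSpan in
/-- The 2-category of finite groupoids, spans, and isomorphism classes of span maps, with composition
by homotopy pullback. -/
instance allSpansBicategory : Bicategory AllSpans.{u} where
  Hom G H := GpdSpan G.of H.of
  id G := GpdSpan.identity G.of
  comp S T := GpdSpan.comp S T
  homCategory G H := GpdSpan.category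
  whiskerLeft S _ _ η := GpdSpan.whiskerLeft S η
  whiskerRight η T := GpdSpan.whiskerRight η T
  associator S T U := GpdSpan.associator S T U
  leftUnitor S := GpdSpan.leftUnitor S
  rightUnitor S := GpdSpan.rightUnitor S
  whiskerLeft_id _ _ := Map.toHom_eq SpanMap.whiskerLeft_id_rel
  whiskerLeft_comp _ _ _ _ η θ := by
    obtain ⟨m, rfl⟩ := Map.toHom_surjective η
    obtain ⟨n, rfl⟩ := Map.toHom_surjective θ
    exact Map.toHom_eq (SpanMap.whiskerLeft_comp_rel m n)
  id_whiskerLeft {_ _ S T} η := by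
    obtain ⟨m, rfl⟩ := Map.toHom_surjective η
    exact ((Iso.eq_comp_inv _).2 (Map.toHom_eq (SpanMap.id_whiskerLeft_rel m))).trans
      (Category.assoc _ _ _)
  comp_whiskerLeft _ _ _ _ η := by
    obtain ⟨m, rfl⟩ := Map.toHom_surjective η
    exact ((Iso.eq_comp_inv _).2 (Map.toHom_eq (SpanMap.comp_whiskerLeft_rel m))).trans
      (Category.assoc _ _ _)
  id_whiskerRight _ _ := Map.toHom_eq SpanMap.id_whiskerRight_rel
  comp_whiskerRight η θ _ := by
    obtain ⟨m, rfl⟩ := Map.toHom_surjective η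
    obtain ⟨n, rfl⟩ := Map.toHom_surjective θ
    exact Map.toHom_eq (SpanMap.comp_whiskerRight_rel m n)
  whiskerRight_id η := by
    obtain ⟨m, rfl⟩ := Map.toHom_surjective η
    exact ((Iso.eq_comp_inv _).2 (Map.toHom_eq (SpanMap.whiskerRight_id_rel m))).trans
      (Category.assoc _ _ _)
  whiskerRight_comp η _ _ := by
    obtain ⟨m, rfl⟩ := Map.toHom_surjective η
    exact (Iso.eq_inv_comp _).2 (Map.toHom_eq (SpanMap.whiskerRight_comp_rel m))
  whisker_assoc _ _ _ η _ := by
    obtain ⟨m, rfl⟩ := Map.toHom_surjective η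
    exact ((Iso.eq_comp_inv _).2 (Map.toHom_eq (SpanMap.whisker_assoc_rel m))).trans
      (Category.assoc _ _ _)
  whisker_exchange η θ := by
    obtain ⟨m, rfl⟩ := Map.toHom_surjective η
    obtain ⟨n, rfl⟩ := Map.toHom_surjective θ
    exact Map.toHom_eq (SpanMap.whisker_exchange_rel m n)
  pentagon _ _ _ _ := Map.toHom_eq SpanMap.pentagon_rel
  triangle _ _ := Map.toHom_eq SpanMap.triangle_rel

section Transport
open Bicategory

universe v' u'

/-- Data of 1-cells which are carried to the 1-cells of a bicategory `B`, compatibly with identities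
and composition up to invertible 2-cells of `B`. -/
structure SubCells (B : Type u') [Bicategory.{w, v'} B] (B' : Type u') where
  obj : B' → B
  Hom : B' → B' → Type v'
  cell {a b : B'} : Hom a b → (obj a ⟶ obj b)
  id (a : B') : Hom a a
  comp {a b c : B'} : Hom a b → Hom b c → Hom a c
  idIso (a : B') : cell (id a) ≅ 𝟙 (obj a)
  compIso {a b c : B'} (f : Hom a b) (g : Hom b c) : cell (comp f g) ≅ cell f ≫ cell g

variable {B : Type u'} [Bicategory.{w, v'} B] {B' : Type u'} (E : SubCells B B')
namespace SubCells

abbrev homCategory (a b : B') : Category (E.Hom a b) where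
  Hom f g := E.cell f ⟶ E.cell g
  id f := 𝟙 (E.cell f)
  comp η θ := η ≫ θ

variable {a b c d e : B'}

variable (f : E.Hom a b) (g : E.Hom b c) (h : E.Hom c d) (k : E.Hom d e)

def whiskerLeft (f : E.Hom a b) {g h : E.Hom b c} (η : E.cell g ⟶ E.cell h) : E.cell (E.comp f g) ⟶ E.cell (E.comp f h) :=
  (E.compIso f g).hom ≫ E.cell f ◁ η ≫ (E.compIso f h).inv

def whiskerRight {f g : E.Hom a b} (η : E.cell f ⟶ E.cell g) (h : E.Hom b c) : E.cell (E.comp f h) ⟶ E.cell (E.comp g h) :=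
  (E.compIso f h).hom ≫ η ▷ E.cell h ≫ (E.compIso g h).inv

def associator : E.cell (E.comp (E.comp f g) h) ≅ E.cell (E.comp f (E.comp g h)) :=
  E.compIso (E.comp f g) h ≪≫ whiskerRightIso (E.compIso f g) (E.cell h) ≪≫ α_ _ _ _ ≪≫
    whiskerLeftIso (E.cell f) (E.compIso g h).symm ≪≫ (E.compIso f (E.comp g h)).symm

def leftUnitor : E.cell (E.comp (E.id a) f) ≅ E.cell f :=
  E.compIso (E.id a) f ≪≫ whiskerRightIso (E.idIso a) (E.cell f) ≪≫ λ_ (E.cell f)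

def rightUnitor : E.cell (E.comp f (E.id b)) ≅ E.cell f :=
  E.compIso f (E.id b) ≪≫ whiskerLeftIso (E.cell f) (E.idIso b) ≪≫ ρ_ (E.cell f)

def iso {a b : B'} {f g : E.Hom a b} (i : E.cell f ≅ E.cell g) :
    letI := E.homCategory a b
    f ≅ g :=
  letI := E.homCategory a b
  { hom := i.hom, inv := i.inv, hom_inv_id := i.hom_inv_id, inv_hom_id := i.inv_hom_id }

theorem wl_id : E.whiskerLeft f (𝟙 (E.cell g)) = 𝟙 _ := by simp [SubCells.whiskerLeft]
theorem id_wr : E.whiskerRight (𝟙 (E.cell f)) g = 𝟙 _ := by simp [SubCells.whiskerRight]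
theorem wl_comp {g h i : E.Hom b c} (η : E.cell g ⟶ E.cell h) (θ : E.cell h ⟶ E.cell i) :
    E.whiskerLeft f (η ≫ θ) = E.whiskerLeft f η ≫ E.whiskerLeft f θ := by simp [SubCells.whiskerLeft]
theorem comp_wr {f g h : E.Hom a b} (η : E.cell f ⟶ E.cell g) (θ : E.cell g ⟶ E.cell h) (i : E.Hom b c) :
    E.whiskerRight (η ≫ θ) i = E.whiskerRight η i ≫ E.whiskerRight θ i := by simp [SubCells.whiskerRight]
theorem id_wl {f g : E.Hom a b} (η : E.cell f ⟶ E.cell g) :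
    E.whiskerLeft (E.id a) η = (E.leftUnitor f).hom ≫ η ≫ (E.leftUnitor g).inv := by
  simpa [SubCells.whiskerLeft, SubCells.leftUnitor] using whisker_exchange_assoc (E.idIso a).hom η
    ((E.idIso a).inv ▷ E.cell g ≫ (E.compIso (E.id a) g).inv)
theorem wr_id {f g : E.Hom a b} (η : E.cell f ⟶ E.cell g) :
    E.whiskerRight η (E.id b) = (E.rightUnitor f).hom ≫ η ≫ (E.rightUnitor g).inv := by
  simpa [SubCells.whiskerRight, SubCells.rightUnitor] using (whisker_exchange_assoc η (E.idIso b).hom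
    (E.cell g ◁ (E.idIso b).inv ≫ (E.compIso g (E.id b)).inv)).symm
theorem comp_wl {h h' : E.Hom c d} (η : E.cell h ⟶ E.cell h') :
    E.whiskerLeft (E.comp f g) η = (E.associator f g h).hom ≫ E.whiskerLeft f (E.whiskerLeft g η) ≫ (E.associator f g h').inv := by
  simpa [SubCells.whiskerLeft, SubCells.associator] using whisker_exchange_assoc (E.compIso f g).hom η
    ((E.compIso f g).inv ▷ E.cell h' ≫ (E.compIso (E.comp f g) h').inv)
theorem wr_comp {f f' : E.Hom a b} (η : E.cell f ⟶ E.cell f') :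
    E.whiskerRight η (E.comp g h) = (E.associator f g h).inv ≫ E.whiskerRight (E.whiskerRight η g) h ≫ (E.associator f' g h).hom := by
  simpa [SubCells.whiskerRight, SubCells.associator] using (whisker_exchange_assoc η (E.compIso g h).hom
    (E.cell f' ◁ (E.compIso g h).inv ≫ (E.compIso f' (E.comp g h)).inv)).symm
theorem w_assoc {g g' : E.Hom b c} (η : E.cell g ⟶ E.cell g') :
    E.whiskerRight (E.whiskerLeft f η) h = (E.associator f g h).hom ≫ E.whiskerLeft f (E.whiskerRight η h) ≫ (E.associator f g' h).inv := by
  simp [SubCells.whiskerLeft, SubCells.whiskerRight, SubCells.associator]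
theorem w_exch {f g : E.Hom a b} {h i : E.Hom b c} (η : E.cell f ⟶ E.cell g) (θ : E.cell h ⟶ E.cell i) :
    E.whiskerLeft f θ ≫ E.whiskerRight η i = E.whiskerRight η h ≫ E.whiskerLeft g θ := by
  simp [SubCells.whiskerLeft, SubCells.whiskerRight, whisker_exchange_assoc]
theorem pent : E.whiskerRight (E.associator f g h).hom k ≫ (E.associator f (E.comp g h) k).hom ≫ E.whiskerLeft f (E.associator g h k).hom =
    (E.associator (E.comp f g) h k).hom ≫ (E.associator f g (E.comp h k)).hom := by
  have := whisker_exchange_assoc (E.compIso f g).hom (E.compIso h k).inv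
    ((α_ (E.cell f) (E.cell g) (E.cell (E.comp h k))).hom ≫
      E.cell f ◁ (E.compIso g (E.comp h k)).inv ≫ (E.compIso f (E.comp g (E.comp h k))).inv)
  simp at this
  simp [SubCells.whiskerLeft, SubCells.whiskerRight, SubCells.associator, this]
theorem tri : (E.associator f (E.id b) g).hom ≫ E.whiskerLeft f (E.leftUnitor g).hom = E.whiskerRight (E.rightUnitor f).hom g := by
  simp [SubCells.whiskerLeft, SubCells.whiskerRight, SubCells.associator, SubCells.leftUnitor, SubCells.rightUnitor]

/-- The 2-category with the given 1-cells and with all 2-cells of `B` between them. -/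
abbrev bicategory : Bicategory.{w, v'} B' where
  Hom := E.Hom
  id := E.id
  comp := E.comp
  homCategory := E.homCategory
  whiskerLeft f _ _ η := E.whiskerLeft f η
  whiskerRight η h := E.whiskerRight η h
  associator f g h := E.iso (E.associator f g h)
  leftUnitor f := E.iso (E.leftUnitor f)
  rightUnitor f := E.iso (E.rightUnitor f)
  whiskerLeft_id := E.wl_id
  whiskerLeft_comp f _ _ _ := E.wl_comp f
  id_whiskerLeft := E.id_wl
  comp_whiskerLeft f g _ _ := E.comp_wl f g
  id_whiskerRight := E.id_wr
  comp_whiskerRight := E.comp_wr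
  whiskerRight_id := E.wr_id
  whiskerRight_comp η g h := E.wr_comp g h η
  whisker_assoc f _ _ η h := E.w_assoc f h η
  whisker_exchange := E.w_exch
  pentagon := E.pent
  triangle := E.tri
end SubCells
end Transport

namespace SpanMap

variable {G H K K' : Type u} [Groupoid.{u} G] [Groupoid.{u} H] [Groupoid.{u} K] [Groupoid.{u} K']
  {l : K ⥤ G} {r : K ⥤ H} {l' : K' ⥤ G} {r' : K' ⥤ H}

theorem symm_naturality {f : K ⥤ K'} (α : ∀ k, l.obj k ⟶ l'.obj (f.obj k))
    (hα : ∀ {k₁ k₂ : K} (a : k₁ ⟶ k₂), l.map a ≫ α k₂ = α k₁ ≫ l'.map (f.map a))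
    (g : K' ⥤ K) (ε : ∀ k, k ⟶ f.obj (g.obj k))
    (hε : ∀ {k₁ k₂ : K'} (a : k₁ ⟶ k₂), a ≫ ε k₂ = ε k₁ ≫ f.map (g.map a))
    {k₁ k₂ : K'} (a : k₁ ⟶ k₂) :
    l'.map a ≫ l'.map (ε k₂) ≫ inv (α (g.obj k₂)) =
      (l'.map (ε k₁) ≫ inv (α (g.obj k₁))) ≫ l.map (g.map a) := by
  rw [← Functor.map_comp_assoc, hε, ← cancel_mono (α (g.obj k₂))]
  simp [hα]

theorem comp_symm_app {f : K ⥤ K'} (α : ∀ k, l.obj k ⟶ l'.obj (f.obj k))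
    (hα : ∀ {k₁ k₂ : K} (a : k₁ ⟶ k₂), l.map a ≫ α k₂ = α k₁ ≫ l'.map (f.map a))
    (g : K' ⥤ K) (ε : ∀ k, k ⟶ f.obj (g.obj k)) (η : ∀ k, g.obj (f.obj k) ⟶ k)
    (h : ∀ k, ε (f.obj k) ≫ f.map (η k) = 𝟙 _) (k : K) :
    (α k ≫ l'.map (ε (f.obj k)) ≫ inv (α (g.obj (f.obj k)))) ≫ l.map (η k) = 𝟙 _ := by
  rw [← cancel_mono (α k)]
  simp [hα, ← Functor.map_comp, h]

theorem symm_comp_app {f : K ⥤ K'} (α : ∀ k, l.obj k ⟶ l'.obj (f.obj k))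
    (g : K' ⥤ K) (ε : ∀ k, k ⟶ f.obj (g.obj k)) (k : K') :
    ((l'.map (ε k) ≫ inv (α (g.obj k))) ≫ α (g.obj k)) ≫ l'.map (inv (ε k)) = 𝟙 _ := by
  simp

/-- A quasi-inverse of a span map whose underlying functor is an equivalence. -/
abbrev symm (m : SpanMap l r l' r') (g : K' ⥤ K) (ε : ∀ k, k ⟶ m.functor.obj (g.obj k))
    (hε : ∀ {k₁ k₂ : K'} (a : k₁ ⟶ k₂), a ≫ ε k₂ = ε k₁ ≫ m.functor.map (g.map a)) :
    SpanMap l' r' l r where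
  functor := g
  left k := l'.map (ε k) ≫ inv (m.left (g.obj k))
  right k := r'.map (ε k) ≫ inv (m.right (g.obj k))
  left_naturality := symm_naturality m.left m.left_naturality g ε hε
  right_naturality := symm_naturality m.right m.right_naturality g ε hε

theorem exists_symm (m : SpanMap l r l' r') [m.functor.IsEquivalence] :
    ∃ n : SpanMap l' r' l r, (m.comp n).Rel (id l r) ∧ (n.comp m).Rel (id l' r') := by
  let e := m.functor.asEquivalence
  let ε : ∀ k, k ⟶ m.functor.obj (m.functor.inv.obj k) := fun k => e.counitInv.app k
  have hε {k₁ k₂ : K'} (a : k₁ ⟶ k₂) :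
      a ≫ ε k₂ = ε k₁ ≫ m.functor.map (m.functor.inv.map a) := e.counitInv.naturality a
  let η : ∀ k, m.functor.inv.obj (m.functor.obj k) ⟶ k := fun k => e.unitInv.app k
  have hη : ∀ k, ε (m.functor.obj k) ≫ m.functor.map (η k) = 𝟙 _ := fun k =>
    e.counitInv_functor_comp k
  refine ⟨symm m m.functor.inv ε hε, ⟨⟨η, fun _ _ f => e.unitInv.naturality f⟩, ?_, ?_⟩,
    ⟨⟨fun k => inv (ε k), fun _ _ f => ?_⟩, ?_, ?_⟩⟩
  · exact fun k => comp_symm_app m.left m.left_naturality _ ε η hη k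
  · exact fun k => comp_symm_app m.right m.right_naturality _ ε η hη k
  · show m.functor.map (m.functor.inv.map f) ≫ inv (ε _) = inv (ε _) ≫ f
    rw [IsIso.comp_inv_eq, Category.assoc, IsIso.eq_inv_comp, hε]
  · exact fun k => symm_comp_app m.left _ ε k
  · exact fun k => symm_comp_app m.right _ ε k

end SpanMap

/-- Every morphism out of `F.obj X` has a unique lift to a morphism out of `X`. -/
def IsDiscreteFibration {K G : Type u} [Groupoid.{u} K] [Groupoid.{u} G] (F : K ⥤ G) : Prop :=
  ∀ (X : K) (f : Σ Y : G, F.obj X ⟶ Y), ∃! f' : Σ Y : K, X ⟶ Y, ⟨F.obj f'.1, F.map f'.2⟩ = f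

namespace IsDiscreteFibration

variable {G H K L : Type u} [Groupoid.{u} G] [Groupoid.{u} H] [Groupoid.{u} K] [Groupoid.{u} L]

theorem id (G : Type u) [Groupoid.{u} G] : IsDiscreteFibration (𝟭 G) :=
  fun X f => ⟨f, rfl, fun _ h => h⟩

theorem comp {F : L ⥤ K} {F' : K ⥤ G} (h : IsDiscreteFibration F) (h' : IsDiscreteFibration F') :
    IsDiscreteFibration (F ⋙ F') := by
  intro X f
  obtain ⟨g, hg, hg'⟩ := h' (F.obj X) f
  obtain ⟨k, rfl, hk'⟩ := h X g
  exact ⟨k, hg, fun k' hk => hk' _ (hg' ⟨F.obj k'.1, F.map k'.2⟩ hk)⟩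

end IsDiscreteFibration

/-- The objects of the strict pullback of `r` and `p`: pairs `(k, l)` with `r k = p l`. -/
def strictPullback {H K L : Type u} [Groupoid.{u} H] [Groupoid.{u} K] [Groupoid.{u} L]
    (r : K ⥤ H) (p : L ⥤ H) : ObjectProperty (Comma r p) :=
  fun x => ∃ h : r.obj x.left = p.obj x.right, x.hom = eqToHom h

namespace strictPullback

instance groupoid {C : Type u} [Groupoid.{u} C] (P : ObjectProperty C) :
    Groupoid.{u} P.FullSubcategory where
  inv f := ObjectProperty.homMk (Groupoid.inv f.hom)
  inv_comp f := by ext; simp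
  comp_inv f := by ext; simp

instance finite {C : Type u} [Groupoid.{u} C] [Finite C] (P : ObjectProperty C) :
    Finite P.FullSubcategory :=
  Finite.of_injective (fun x => x.obj) fun _ _ h => ObjectProperty.FullSubcategory.ext h

instance finite_hom {C : Type u} [Groupoid.{u} C] (P : ObjectProperty C)
    [∀ X Y : C, Finite (X ⟶ Y)] (X Y : P.FullSubcategory) : Finite (X ⟶ Y) :=
  Finite.of_injective (fun f => f.hom) fun _ _ h => ObjectProperty.hom_ext _ h

variable {H K L : Type u} [Groupoid.{u} H] [Groupoid.{u} K] [Groupoid.{u} L]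
  (r : K ⥤ H) (p : L ⥤ H)


theorem sigma_eq_iff {C : Type u} [Groupoid.{u} C] {X Y Y' : C} (f : X ⟶ Y) (f' : X ⟶ Y') :
    (⟨Y, f⟩ : Σ Y : C, X ⟶ Y) = ⟨Y', f'⟩ ↔ ∃ h : Y = Y', f ≫ eqToHom h = f' := by
  constructor
  · intro h
    cases h
    exact ⟨rfl, by simp⟩
  · rintro ⟨rfl, rfl⟩
    simp

theorem fst_isDiscreteFibration (hp : IsDiscreteFibration p) :
    IsDiscreteFibration ((strictPullback r p).ι ⋙ Comma.fst r p) := by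
  rintro ⟨⟨k, l, e⟩, h, he⟩ ⟨k', a⟩
  change r.obj k = p.obj l at h
  change e = eqToHom h at he
  subst he
  change k ⟶ k' at a
  obtain ⟨⟨l', b⟩, hb, hb'⟩ := hp l ⟨r.obj k', eqToHom h.symm ≫ r.map a⟩
  obtain ⟨h', hb⟩ := (sigma_eq_iff _ _).1 hb
  refine ⟨⟨⟨⟨k', l', eqToHom h'.symm⟩, h'.symm, rfl⟩, ObjectProperty.homMk
    { left := a, right := b, w := ?_ }⟩, rfl, ?_⟩
  · show r.map a ≫ eqToHom h'.symm = eqToHom h ≫ p.map b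
    rw [← cancel_mono (eqToHom h'), Category.assoc, Category.assoc, hb]
    simp
  · rintro ⟨⟨⟨k'', l'', e''⟩, h'', he''⟩, f⟩ hf
    change r.obj k'' = p.obj l'' at h''
    change e'' = eqToHom h'' at he''
    subst he''
    obtain ⟨⟨a', b', w⟩⟩ := f
    change (⟨k'', a'⟩ : Σ Y : K, k ⟶ Y) = ⟨k', a⟩ at hf
    cases hf
    change r.map a ≫ eqToHom h'' = eqToHom h ≫ p.map b' at w
    have := hb' ⟨l'', b'⟩ ((sigma_eq_iff _ _).2 ⟨h''.symm, by
      rw [← cancel_epi (eqToHom h), ← Category.assoc, ← w]; simp⟩)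
    cases this
    rfl

theorem ι_isEquivalence (hp : IsDiscreteFibration p) : (strictPullback r p).ι.IsEquivalence where
  essSurj := by
    refine ⟨fun ⟨k, l, e⟩ => ?_⟩
    change r.obj k ⟶ p.obj l at e
    obtain ⟨⟨l', b⟩, hb, -⟩ := hp l ⟨r.obj k, inv e⟩
    obtain ⟨h, hb⟩ := (sigma_eq_iff _ _).1 hb
    refine ⟨⟨⟨k, l', eqToHom h.symm⟩, h.symm, rfl⟩, ?_⟩
    change Nonempty ((⟨k, l', eqToHom h.symm⟩ : Comma r p) ≅ ⟨k, l, e⟩)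
    refine ⟨Comma.isoMk (Iso.refl k) (asIso (inv b)) ?_⟩
    change r.map (𝟙 k) ≫ e = eqToHom h.symm ≫ p.map (inv b)
    change p.map b ≫ eqToHom h = inv e at hb
    rw [Functor.map_inv, IsIso.eq_comp_inv, ← cancel_mono (eqToHom h), Category.assoc, hb]
    simp

end strictPullback

/-- The strict pullback of two spans maps to their homotopy pullback. -/
abbrev SpanMap.strictInclusion {G H K L M : Type u} [Groupoid.{u} G] [Groupoid.{u} H]
    [Groupoid.{u} K] [Groupoid.{u} L] [Groupoid.{u} M]
    (l : K ⥤ G) (r : K ⥤ H) (p : L ⥤ H) (q : L ⥤ M) :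
    SpanMap ((strictPullback r p).ι ⋙ Comma.fst r p ⋙ l)
      ((strictPullback r p).ι ⋙ Comma.snd r p ⋙ q) (SpanMap.fstLeg l r p)
      (SpanMap.sndLeg r p q) where
  functor := (strictPullback r p).ι
  left x := 𝟙 (l.obj x.obj.left)
  right x := 𝟙 (q.obj x.obj.right)
  left_naturality f := comp_id_eq_id_comp _
  right_naturality f := comp_id_eq_id_comp _

theorem GpdSpan.Map.isIso_toHom {G H : FinGpd.{u}} {S T : GpdSpan G H} (m : S.Map T)
    (h : m.functor.IsEquivalence) : IsIso (GpdSpan.Map.toHom m) := by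
  obtain ⟨n, h₁, h₂⟩ := SpanMap.exists_symm m
  exact (GpdSpan.isoMk m n h₁ h₂).isIso_hom

/-- Spans `G ← K ⟶ H` of finite groupoids whose left leg is a discrete fibration. -/
structure BurnSpan (G H : FinGpd.{u}) : Type (u + 1) where
  span : GpdSpan G H
  isDiscreteFibration : IsDiscreteFibration span.left

namespace BurnSpan

/-- The identity span. -/
def identity (G : FinGpd.{u}) : BurnSpan G G := ⟨GpdSpan.identity G, .id G⟩

/-- Composition of spans by strict pullback. -/
def comp {G H M : FinGpd.{u}} (S : BurnSpan G H) (T : BurnSpan H M) : BurnSpan G M where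
  span :=
    { apex := ⟨(strictPullback S.span.right T.span.left).FullSubcategory⟩
      left := (strictPullback S.span.right T.span.left).ι ⋙
        Comma.fst S.span.right T.span.left ⋙ S.span.left
      right := (strictPullback S.span.right T.span.left).ι ⋙
        Comma.snd S.span.right T.span.left ⋙ T.span.right }
  isDiscreteFibration := (strictPullback.fst_isDiscreteFibration _ _ T.isDiscreteFibration).comp
    S.isDiscreteFibration

/-- The strict pullback is equivalent to the homotopy pullback. -/
def compIso {G H M : FinGpd.{u}} (S : BurnSpan G H) (T : BurnSpan H M) :
    (S.comp T).span ≅ S.span.comp T.span :=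
  @asIso _ _ _ _ (GpdSpan.Map.toHom (S := (S.comp T).span) (T := S.span.comp T.span)
      (SpanMap.strictInclusion S.span.left S.span.right T.span.left T.span.right))
    (GpdSpan.Map.isIso_toHom _ (strictPullback.ι_isEquivalence _ _ T.isDiscreteFibration))

end BurnSpan

/-- Objects of the global effective Burnside 2-category: finite groupoids. -/
structure BurnGlo : Type (u + 1) where
  of : FinGpd.{u}

/-- The 1-cells of the global effective Burnside 2-category, with their composition, as 1-cells of
the 2-category of all spans of finite groupoids. -/
def burnGloCells : SubCells AllSpans.{u} BurnGlo.{u} where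
  obj G := ⟨G.of⟩
  Hom G H := BurnSpan G.of H.of
  cell S := S.span
  id G := BurnSpan.identity G.of
  comp S T := S.comp T
  idIso G := Iso.refl _
  compIso S T := BurnSpan.compIso S T

/-- The global effective Burnside 2-category: finite groupoids, spans whose left leg is a discrete
fibration, isomorphism classes of span maps, composition by pullback. -/
instance burnGloBicategory : Bicategory BurnGlo.{u} := burnGloCells.bicategory

/-- Functors preserving pullbacks, finite coproducts, and epimorphisms. -/
def IsPce {C : Type u} [Category.{v} C] {D : Type u} [Category.{v} D] : ObjectProperty (C ⥤ D) :=
  fun F => PreservesLimitsOfShape WalkingCospan F ∧ PreservesFiniteCoproducts F ∧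
    F.PreservesEpimorphisms

/-- Categories with pullbacks and finite coproducts. -/
structure CatPce : Type (max (u + 1) (v + 1)) where
  carrier : Type u
  [category : Category.{v} carrier]
  [hasPullbacks : HasPullbacks carrier]
  [hasFiniteCoproducts : HasFiniteCoproducts carrier]

namespace CatPce

instance : CoeSort CatPce.{v, u} (Type u) := ⟨CatPce.carrier⟩
attribute [instance] CatPce.category CatPce.hasPullbacks CatPce.hasFiniteCoproducts

/-- The category of functors `C ⥤ D` preserving pullbacks, finite coproducts and epimorphisms,
with all natural transformations between them. -/
abbrev Fun (C D : CatPce.{v, u}) : Type (max u v) := (IsPce (C := C) (D := D)).FullSubcategory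

variable {C D E : CatPce.{v, u}}

theorem isPce_id (C : CatPce.{v, u}) : IsPce (𝟭 C) :=
  ⟨inferInstance, inferInstance, inferInstance⟩

theorem isPce_comp {F : C ⥤ D} {F' : D ⥤ E} (h : IsPce F) (h' : IsPce F') : IsPce (F ⋙ F') := by
  obtain ⟨h₁, h₂, h₃⟩ := h
  obtain ⟨h₁', h₂', h₃'⟩ := h'
  exact ⟨inferInstance, inferInstance, inferInstance⟩

/-- The 2-category of categories with pullbacks and finite coproducts, functors preserving
pullbacks, finite coproducts and epimorphisms, and natural transformations. -/
instance bicategory : Bicategory CatPce.{v, u} where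
  Hom C D := Fun C D
  id C := ⟨𝟭 C, isPce_id C⟩
  comp F F' := ⟨F.obj ⋙ F'.obj, isPce_comp F.property F'.property⟩
  homCategory C D := inferInstance
  whiskerLeft F _ _ η := ObjectProperty.homMk (Functor.whiskerLeft F.obj η.hom)
  whiskerRight η F := ObjectProperty.homMk (Functor.whiskerRight η.hom F.obj)
  associator F F' F'' := ObjectProperty.isoMk _ (Functor.associator F.obj F'.obj F''.obj)
  leftUnitor F := ObjectProperty.isoMk _ F.obj.leftUnitor
  rightUnitor F := ObjectProperty.isoMk _ F.obj.rightUnitor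

end CatPce

/-- Freely adjoining finite coproducts to a category: finite families of objects, and maps of
families. -/
abbrev FinCoprod (C : Type u) [Category.{v} C] : Type (u + 1) :=
  ObjectProperty.FullSubcategory fun X : FormalCoproduct.{u} C => Finite X.I

namespace FinCoprod

instance hasPullbacks (C : Type u) [Groupoid.{u} C] : HasPullbacks (FinCoprod C) := by
  have (X Y Z : C) (f : X ⟶ Z) (g : Y ⟶ Z) : HasPullback f g := hasPullback_of_left_iso f g
  refine @hasPullbacks_of_hasLimit_cospan _ _ fun {X Y Z f g} => ?_
  have : Finite X.obj.I := X.property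
  have : Finite Y.obj.I := Y.property
  let pb : ∀ i : Function.Pullback f.hom.f g.hom.f,
      PullbackCone (f.hom.φ i.1.1 ≫ eqToHom (by rw [i.2])) (g.hom.φ i.1.2) :=
    fun _ => pullback.cone _ _
  let W : FinCoprod C := ⟨(FormalCoproduct.pullbackCone f.hom g.hom pb).pt,
    inferInstanceAs (Finite (Function.Pullback f.hom.f g.hom.f))⟩
  have h := FormalCoproduct.isPullback f.hom g.hom pb (fun _ => pullback.isLimit _ _)
  have h' : IsPullback (ObjectProperty.homMk (FormalCoproduct.pullbackCone f.hom g.hom pb).fst : W ⟶ X)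
    (ObjectProperty.homMk (FormalCoproduct.pullbackCone f.hom g.hom pb).snd : W ⟶ Y) f g :=
    IsPullback.of_map (ObjectProperty.ι _) (by ext1; exact h.w) h
  exact h'.hasPullback

instance hasFiniteCoproducts (C : Type u) [Category.{v} C] : HasFiniteCoproducts (FinCoprod C) := by
  refine ⟨fun n => ?_⟩
  have key (J : Type u) [Finite J] (F : J → FinCoprod C) : HasColimit (Discrete.functor F) := by
    have (i : J) : Finite (F i).obj.I := (F i).property
    let F' (i : J) := (F i).obj
    let c : Cofan F := Cofan.mk ⟨(FormalCoproduct.cofan _ F').pt,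
        inferInstanceAs (Finite (Σ i : J, (F i).obj.I))⟩
      fun i => ObjectProperty.homMk ((FormalCoproduct.cofan _ F').inj i)
    let d (s : Cofan F) : (FormalCoproduct.cofan _ F').pt ⟶ s.pt.obj :=
      (FormalCoproduct.cofanHomEquiv _ F' s.pt.obj).symm fun i => (s.inj i).hom
    refine ⟨⟨⟨c, Cofan.IsColimit.mk c (fun s => ObjectProperty.homMk (d s)) (fun s i => ?_)
      (fun s m h => ?_)⟩⟩⟩
    · apply ObjectProperty.hom_ext
      exact congrFun ((FormalCoproduct.cofanHomEquiv _ F' s.pt.obj).right_inv fun i => (s.inj i).hom) i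
    · ext1
      exact (Equiv.eq_symm_apply _).2 (funext fun i => congrArg (·.hom) (h i))
  have : HasColimitsOfShape (Discrete (ULift.{u} (Fin n))) (FinCoprod C) :=
    ⟨fun F => have := key _ (F.obj ∘ Discrete.mk); hasColimit_of_iso (F := Discrete.functor (F.obj ∘ Discrete.mk)) 
      Discrete.natIsoFunctor⟩
  exact hasColimitsOfShape_of_equivalence (Discrete.equivalence (Equiv.ulift : ULift.{u} (Fin n) ≃ Fin n))

end FinCoprod

/-- The free finite coproduct completion of a groupoid. -/
def CatPce.free (G : Type u) [Groupoid.{u} G] : CatPce.{u, u + 1} := ⟨FinCoprod G⟩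

/-- The full sub-2-category of `CatPce` spanned by the categories obtained from finite groupoids
by freely adjoining finite coproducts. -/
abbrev CogloCat : Type (u + 2) :=
  Bicategory.InducedBicategory CatPce.{u, u + 1}
    (Subtype.val : { C : CatPce.{u, u + 1} // ∃ G : FinGpd.{u}, C = CatPce.free G } → _)

/-- The object of `CogloCat` given by a finite groupoid. -/
def CogloCat.of (G : FinGpd.{u}) : CogloCat.{u} :=
  (⟨CatPce.free G, G, rfl⟩ : { C : CatPce.{u, u + 1} // ∃ G : FinGpd.{u}, C = CatPce.free G })

/-- An equivalence of 2-categories: a pseudofunctor which is essentially surjective on objects up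
to internal equivalence, and which induces equivalences on categories of 1-cells. -/
def IsBiequivalence {B : Type*} [Bicategory B] {C : Type*} [Bicategory C]
    (F : Pseudofunctor B C) : Prop :=
  (∀ c : C, ∃ b : B, Nonempty (Bicategory.Equivalence (F.obj b) c)) ∧
    ∀ a b : B, (F.mapFunctor a b).IsEquivalence

end
end GlobalBurnside

/-! Call a map from a one-member family into a family a point. Points detect everything: a morphism
of families is the same thing as a natural function on points. Over a groupoid, two points with the
same index differ by a unique isomorphism, so epimorphisms, finite coproducts and pullbacks can also
be tested on points.

A span `G ← K ⟶ H` with legs `l`, `r` should act on `X` by a functor whose points of shape `A` form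
the coend over `k` of `Hom(A, r k) × Hom(l k, X)`. `Realization` axiomatizes such a functor, for
arbitrary spans, so that no formula for its values is needed. From the coend description alone
follow preservation of pullbacks, finite coproducts and epimorphisms (`Realization.isPce`) and a Kan
extension property (`hom_ext`, `exists_desc`): transformations out of a realization are determined
by, and can be prescribed on, its unit. Hence every span map induces exactly one compatible
transformation (`IsLift`), and isomorphic span maps induce the same one.

If `l` is a discrete fibration, then `Hom(l k, X)` is the sum of `Hom(k, k')` over the objects `k'`
of the fibres over the members of `X`. By the co-Yoneda lemma the coend collapses to the points of
the family of all `r k'`, so a realization exists (`exists_of_isDiscreteFibration`). If the target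
span has such a left leg, span maps up to isomorphism correspond bijectively to natural
transformations (`exists_spanMap`, `rel_of_isLift`). Conversely, a functor `F` preserving pullbacks
and finite coproducts realizes the span whose apex is the category of elements of the index sets of
the values of `F` on one-member families (`Realization.ofIsPce`). This gives the local equivalences.

For pseudofunctoriality, composites of realizations realize homotopy pullbacks. The strict composite
of Burnside spans has its own chosen realization, which is compared with the composite realization
through the equivalence of strict and homotopy pullback. Every coherence law holds because induced
transformations are unique and the structural isomorphisms of functors are compatible with those of
spans. -/

namespace GlobalBurnside
noncomputable section

/-! ### Families and their points -/

namespace FinCoprod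

section Category

variable (C : Type u) [Category.{v} C]

/-- The one-member families. -/
def incl : C ⥤ FinCoprod C where
  obj X := ⟨(FormalCoproduct.incl C).obj X, inferInstanceAs (Finite PUnit)⟩
  map f := ObjectProperty.homMk ((FormalCoproduct.incl C).map f)

variable {C}

/-- The map from a one-member family given by a member of the target. -/
def pt (Y : FinCoprod C) (i : Y.obj.I) {X : C} (f : X ⟶ Y.obj.obj i) : (incl C).obj X ⟶ Y :=
  ObjectProperty.homMk (FormalCoproduct.Hom.fromIncl i f)

/-- The index of the member of `Y` hit by a map from a one-member family. -/
def idx {X : C} {Y : FinCoprod C} (x : (incl C).obj X ⟶ Y) : Y.obj.I := x.hom.f PUnit.unit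

/-- The component of a map from a one-member family. -/
def component {X : C} {Y : FinCoprod C} (x : (incl C).obj X ⟶ Y) : X ⟶ Y.obj.obj (idx x) :=
  x.hom.φ PUnit.unit

@[simp] theorem idx_pt (Y : FinCoprod C) (i : Y.obj.I) {X : C} (f : X ⟶ Y.obj.obj i) :
    idx (pt Y i f) = i := rfl

@[simp] theorem idx_comp {X : C} {Y Z : FinCoprod C} (x : (incl C).obj X ⟶ Y) (f : Y ⟶ Z) :
    idx (x ≫ f) = f.hom.f (idx x) := rfl

theorem incl_map_comp_pt {X X' : C} {Y : FinCoprod C} {i : Y.obj.I} (g : X ⟶ X')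
    (f : X' ⟶ Y.obj.obj i) : (incl C).map g ≫ pt Y i f = pt Y i (g ≫ f) := rfl

theorem pt_ext {X : C} {Y : FinCoprod C} {x y : (incl C).obj X ⟶ Y} (h : idx x = idx y)
    (h' : component x ≫ eqToHom (by rw [h]) = component y) : x = y := by
  ext1
  exact FormalCoproduct.hom_ext (funext fun _ => h) fun _ => h'

theorem component_congr {X : C} {Y : FinCoprod C} {x y : (incl C).obj X ⟶ Y} (h : x = y) :
    component x ≫ eqToHom (by rw [h]) = component y := by
  subst h; simp

theorem incl_map_injective {X Y : C} {f g : X ⟶ Y} (h : (incl C).map f = (incl C).map g) : f = g :=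
  (Category.comp_id _).symm.trans (component_congr h)

/-- Morphisms of families are determined by their effect on maps from one-member families. -/
theorem hom_ext_pt {Y T : FinCoprod C} {f g : Y ⟶ T}
    (h : ∀ (X : C) (y : (incl C).obj X ⟶ Y), y ≫ f = y ≫ g) : f = g := by
  ext1
  refine (FormalCoproduct.hom_ext_iff' _ _).2 fun i => ?_
  have hi := h _ (pt Y i (𝟙 _))
  have hc := component_congr hi
  have e (k : Y ⟶ T) : component (pt Y i (𝟙 _) ≫ k) = k.hom.φ i := Category.id_comp _
  rw [e, e] at hc
  exact ⟨congrArg idx hi, hc⟩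

/-- Natural functions on maps from one-member families come from morphisms of families. -/
theorem exists_hom_of_pt {Y T : FinCoprod C}
    (τ : ∀ X : C, ((incl C).obj X ⟶ Y) → ((incl C).obj X ⟶ T))
    (hτ : ∀ {X X' : C} (g : X ⟶ X') (y : (incl C).obj X' ⟶ Y),
      τ X ((incl C).map g ≫ y) = (incl C).map g ≫ τ X' y) :
    ∃ f : Y ⟶ T, ∀ (X : C) (y : (incl C).obj X ⟶ Y), y ≫ f = τ X y := by
  let f : Y ⟶ T := ObjectProperty.homMk
    { f := fun i => idx (τ _ (pt Y i (𝟙 _))), φ := fun i => component (τ _ (pt Y i (𝟙 _))) }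
  refine ⟨f, fun X y => ?_⟩
  have h : y = (incl C).map (component y) ≫ pt Y (idx y) (𝟙 _) := by
    rw [incl_map_comp_pt, Category.comp_id]; rfl
  exact (congrArg (· ≫ f) h).trans ((Category.assoc _ _ _).trans
    ((congrArg ((incl C).map (component y) ≫ ·) (by
      refine pt_ext rfl ?_
      exact (Category.comp_id _).trans (Category.id_comp _))).trans ((hτ _ _).symm.trans
        (congrArg (τ X) h.symm))))

/-- A family of families, as a family indexed by the disjoint union. -/
def sigma {n : ℕ} (X : Fin n → FinCoprod C) : FinCoprod C :=
  ⟨⟨Σ i, (X i).obj.I, fun p => (X p.1).obj.obj p.2⟩,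
    have (i : Fin n) : Finite (X i).obj.I := (X i).property
    inferInstanceAs (Finite (Σ i, (X i).obj.I))⟩

def sigmaInj {n : ℕ} (X : Fin n → FinCoprod C) (i : Fin n) : X i ⟶ sigma X :=
  ObjectProperty.homMk ⟨fun x => ⟨i, x⟩, fun x => 𝟙 _⟩

/-- The index of a point of the disjoint union records its summand. An arbitrary coproduct cofan
inherits this by mapping to the explicit disjoint union. -/
theorem exists_of_comp_sigmaInj_eq {n : ℕ} {X : Fin n → FinCoprod C} {i i' : Fin n} {A : C}
    {x : (incl C).obj A ⟶ X i} {x' : (incl C).obj A ⟶ X i'}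
    (h : x ≫ sigmaInj X i = x' ≫ sigmaInj X i') : ∃ e : i = i', x ≫ eqToHom (by rw [e]) = x' := by
  have h₁ : (⟨i, idx x⟩ : Σ i, (X i).obj.I) = ⟨i', idx x'⟩ := congrArg idx h
  obtain rfl : i = i' := congrArg Sigma.fst h₁
  refine ⟨rfl, ?_⟩
  have h₂ : idx x = idx x' := by simpa using h₁
  have h₃ := component_congr h
  have e (z : (incl C).obj A ⟶ X i) : component (z ≫ sigmaInj X i) = component z :=
    Category.comp_id _
  rw [e, e] at h₃
  rw [eqToHom_refl, Category.comp_id]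
  exact pt_ext h₂ h₃

/-- Two copies of a family. -/
def double (Y : FinCoprod C) : FinCoprod C :=
  ⟨⟨Y.obj.I × Bool, fun p => Y.obj.obj p.1⟩,
    have : Finite Y.obj.I := Y.property
    inferInstanceAs (Finite (Y.obj.I × Bool))⟩

/-- The map to two copies of a family given by a choice of copy for each member. -/
def toDouble (Y : FinCoprod C) (s : Y.obj.I → Bool) : Y ⟶ double Y :=
  ObjectProperty.homMk ⟨fun i => (i, s i), fun i => 𝟙 _⟩

theorem comp_toDouble_eq {X Y : FinCoprod C} (f : X ⟶ Y) {s t : Y.obj.I → Bool}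
    (h : ∀ x : X.obj.I, s (f.hom.f x) = t (f.hom.f x)) : f ≫ toDouble Y s = f ≫ toDouble Y t := by
  refine hom_ext_pt fun A x => ?_
  refine pt_ext (Prod.ext rfl (h _)) ?_
  exact Category.comp_id _

-- If `P` failed at `i`, the constant choice and the choice that switches copies only at `i` would
-- agree on `P` and yet give different maps. This detects surjectivity on indices from cancellation
-- alone, both for epimorphisms and for coproduct injections.
open Classical in
theorem surjective_of_toDouble {Y : FinCoprod C} (P : Y.obj.I → Prop)
    (h : ∀ s t : Y.obj.I → Bool, (∀ i, P i → s i = t i) → toDouble Y s = toDouble Y t)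
    (i : Y.obj.I) : P i := by
  by_contra hi
  have := h (fun _ => true) (fun j => decide (j ≠ i)) (fun j hj => by
    have : j ≠ i := fun e => hi (e ▸ hj)
    simp [this])
  have := congrArg (fun k => (k.hom.f i).2) this
  simp [toDouble] at this

theorem surjective_of_epi {X Y : FinCoprod C} (f : X ⟶ Y) [Epi f] : Function.Surjective f.hom.f :=
  surjective_of_toDouble _ fun s t h => (cancel_epi f).1 (comp_toDouble_eq f fun x => h _ ⟨x, rfl⟩)

end Category

/-! ### Families over a groupoid: epimorphisms, coproducts and pullbacks tested on points -/

section Groupoid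

variable {C : Type u} [Groupoid.{u} C]

/-- The component of a point is invertible, hence can be cancelled. -/
theorem incl_map_comp_injective {X X' : C} {Y : FinCoprod C} (y : (incl C).obj X' ⟶ Y)
    {g g' : X ⟶ X'} (h : (incl C).map g ≫ y = (incl C).map g' ≫ y) : g = g' := by
  exact (cancel_mono (component y)).1 ((Category.comp_id _).symm.trans (component_congr h))

theorem comp_eqToHom_inv_comp_eqToHom {a b c d : C} (x : a ⟶ b) (h : b = c) (y : d ⟶ c)
    (h' : c = b) : ((x ≫ eqToHom h ≫ inv y) ≫ y) ≫ eqToHom h' = x := by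
  subst h; simp

/-- Both components are isomorphisms onto the same member, so one can be composed with the inverse
of the other. This is where invertibility in `C` turns statements about points into statements about
indices. -/
theorem exists_of_idx_eq {X X' : C} {Y : FinCoprod C} (x : (incl C).obj X ⟶ Y)
    (y : (incl C).obj X' ⟶ Y) (h : idx x = idx y) : ∃ g : X ⟶ X', (incl C).map g ≫ y = x := by
  refine ⟨component x ≫ eqToHom (by rw [h]) ≫ inv (component y), pt_ext h.symm ?_⟩
  exact comp_eqToHom_inv_comp_eqToHom _ _ _ _

theorem exists_lift_of_surjective {X Y : FinCoprod C} {f : X ⟶ Y}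
    (hf : Function.Surjective f.hom.f) {A : C} (y : (incl C).obj A ⟶ Y) :
    ∃ x : (incl C).obj A ⟶ X, x ≫ f = y := by
  obtain ⟨i, hi⟩ := hf (idx y)
  obtain ⟨g, hg⟩ := exists_of_idx_eq y (pt X i (𝟙 _) ≫ f) hi.symm
  exact ⟨(incl C).map g ≫ pt X i (𝟙 _), (Category.assoc _ _ _).trans hg⟩

theorem epi_of_exists_lift {X Y : FinCoprod C} {f : X ⟶ Y}
    (h : ∀ (A : C) (y : (incl C).obj A ⟶ Y), ∃ x, x ≫ f = y) : Epi f := by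
  refine ⟨fun a b e => hom_ext_pt fun A y => ?_⟩
  obtain ⟨x, rfl⟩ := h A y
  simp [e]

/-- A cofan is a coproduct if every map from a one-member family factors uniquely through exactly
one of the members of the cofan. -/
theorem isColimit_cofan_of_pt {n : ℕ} {X : Fin n → FinCoprod C} (c : Cofan X)
    (h : ∀ (A : C) (x : (incl C).obj A ⟶ c.pt), ∃ i, ∃ y : (incl C).obj A ⟶ X i, y ≫ c.inj i = x)
    (h' : ∀ (A : C) {i i' : Fin n} (y : (incl C).obj A ⟶ X i) (y' : (incl C).obj A ⟶ X i'),
      y ≫ c.inj i = y' ≫ c.inj i' → ∃ e : i = i', y ≫ eqToHom (by rw [e]) = y') :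
    Nonempty (IsColimit c) := by
  choose i y hy using h
  have key (s : Cofan X) : ∃ d : c.pt ⟶ s.pt, ∀ j, c.inj j ≫ d = s.inj j := by
    -- The value on a point does not depend on the chosen factorization; both naturality and the
    -- cofan equations reduce to this.
    have aux (A : C) {j j' : Fin n} (z : (incl C).obj A ⟶ X j) (z' : (incl C).obj A ⟶ X j')
        (e : z ≫ c.inj j = z' ≫ c.inj j') : z ≫ s.inj j = z' ≫ s.inj j' := by
      obtain ⟨rfl, e⟩ := h' A z z' e
      simp at e
      rw [e]
    obtain ⟨d, hd⟩ := exists_hom_of_pt (Y := c.pt) (T := s.pt)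
      (fun A x => y A x ≫ s.inj (i A x)) (fun {A A'} g x => by
        rw [← Category.assoc]
        exact aux A _ _ (by rw [hy, Category.assoc, hy]))
    refine ⟨d, fun j => hom_ext_pt fun A z => ?_⟩
    rw [← Category.assoc, hd]
    exact aux A _ _ (hy _ _)
  choose d hd using key
  refine ⟨Cofan.IsColimit.mk c d hd fun s m hm => hom_ext_pt fun A x => ?_⟩
  rw [← hy A x, Category.assoc, Category.assoc, hm, hd]

/-- The injections of a coproduct are jointly epimorphic, so by the doubling argument they jointly
hit every index; an isomorphism then corrects the component. -/
theorem exists_comp_inj_eq {n : ℕ} {X : Fin n → FinCoprod C} {c : Cofan X} (hc : IsColimit c)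
    {A : C} (x : (incl C).obj A ⟶ c.pt) : ∃ i, ∃ y : (incl C).obj A ⟶ X i, y ≫ c.inj i = x := by
  obtain ⟨i, j, hj⟩ := surjective_of_toDouble (Y := c.pt)
    (fun k => ∃ i j, (c.inj i).hom.f j = k)
    (fun s t hst => Cofan.IsColimit.hom_ext hc _ _ fun i =>
      comp_toDouble_eq _ fun j => hst _ ⟨i, j, rfl⟩) (idx x)
  obtain ⟨g, hg⟩ := exists_of_idx_eq x (pt (X i) j (𝟙 _) ≫ c.inj i) hj.symm
  exact ⟨i, (incl C).map g ≫ pt (X i) j (𝟙 _), (Category.assoc _ _ _).trans hg⟩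

theorem exists_of_comp_inj_eq {n : ℕ} {X : Fin n → FinCoprod C} {c : Cofan X} (hc : IsColimit c)
    {A : C} {i i' : Fin n} {x : (incl C).obj A ⟶ X i} {x' : (incl C).obj A ⟶ X i'}
    (h : x ≫ c.inj i = x' ≫ c.inj i') : ∃ e : i = i', x ≫ eqToHom (by rw [e]) = x' := by
  refine exists_of_comp_sigmaInj_eq (X := X) ?_
  have e (j : Fin n) : c.inj j ≫ Cofan.IsColimit.desc hc (sigmaInj X) = sigmaInj X j :=
    Cofan.IsColimit.fac hc _ _
  rw [← e, ← e, reassoc_of% h]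

/-- A commutative square is a pullback if it is so on maps from one-member families. -/
theorem isPullback_of_pt {P X Y Z : FinCoprod C} {fst : P ⟶ X} {snd : P ⟶ Y} {f : X ⟶ Z} {g : Y ⟶ Z}
    (w : fst ≫ f = snd ≫ g)
    (h : ∀ (A : C) (x : (incl C).obj A ⟶ X) (y : (incl C).obj A ⟶ Y), x ≫ f = y ≫ g →
      ∃ p : (incl C).obj A ⟶ P, p ≫ fst = x ∧ p ≫ snd = y)
    (h' : ∀ (A : C) (p q : (incl C).obj A ⟶ P), p ≫ fst = q ≫ fst → p ≫ snd = q ≫ snd → p = q) :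
    IsPullback fst snd f g := by
  choose p hp hp' using h
  have key (s : PullbackCone f g) : ∃ d : s.pt ⟶ P, d ≫ fst = s.fst ∧ d ≫ snd = s.snd := by
    obtain ⟨d, hd⟩ := exists_hom_of_pt (Y := s.pt) (T := P)
      (fun A x => p A (x ≫ s.fst) (x ≫ s.snd) (by simp [s.condition]))
      (fun k x => h' _ _ _ (by simp [hp]) (by simp [hp']))
    exact ⟨d, hom_ext_pt fun A x => by rw [← Category.assoc, hd, hp],
      hom_ext_pt fun A x => by rw [← Category.assoc, hd, hp']⟩
  choose d hd hd' using key
  refine ⟨⟨w⟩, ⟨PullbackCone.IsLimit.mk w d hd hd' fun s m hm hm' => hom_ext_pt fun A x => ?_⟩⟩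
  exact h' _ _ _ (by simp [hm, hd]) (by simp [hm', hd'])

end Groupoid

end FinCoprod

open FinCoprod

/-! ### Realizations of spans -/

section

variable {G H M N K K' K'' L L' P : Type u}
  [Groupoid.{u} G] [Groupoid.{u} H] [Groupoid.{u} M] [Groupoid.{u} N]
  [Groupoid.{u} K] [Groupoid.{u} K'] [Groupoid.{u} K'']
  [Groupoid.{u} L] [Groupoid.{u} L'] [Groupoid.{u} P]

/-- A functor between free finite coproduct completions which represents a span: maps from a
one-member family `A` to the value at `X` are given by the coend over `k` of the maps `A ⟶ r k` and
`l k ⟶ X`. -/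
structure Realization (l : K ⥤ G) (r : K ⥤ H) where
  functor : FinCoprod G ⥤ FinCoprod H
  unit (k : K) : (incl H).obj (r.obj k) ⟶ functor.obj ((incl G).obj (l.obj k))
  unit_naturality {k k' : K} (f : k ⟶ k') :
    (incl H).map (r.map f) ≫ unit k' = unit k ≫ functor.map ((incl G).map (l.map f))
  exists_factor {X : FinCoprod G} {A : H} (x : (incl H).obj A ⟶ functor.obj X) :
    ∃ (k : K) (b : A ⟶ r.obj k) (a : (incl G).obj (l.obj k) ⟶ X),
      (incl H).map b ≫ unit k ≫ functor.map a = x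
  -- Since `K` is a groupoid, the zigzags generating the coend relation compose to a single morphism
  -- `f`.
  factor_unique {X : FinCoprod G} {A : H} {k k' : K} (b : A ⟶ r.obj k)
    (a : (incl G).obj (l.obj k) ⟶ X) (b' : A ⟶ r.obj k') (a' : (incl G).obj (l.obj k') ⟶ X) :
    (incl H).map b ≫ unit k ≫ functor.map a = (incl H).map b' ≫ unit k' ≫ functor.map a' →
      ∃ f : k ⟶ k', (incl G).map (l.map f) ≫ a' = a ∧ b ≫ r.map f = b'

namespace Realization

/-! ### Exactness and the universal property of a realization -/

section

variable {l : K ⥤ G} {r : K ⥤ H} (R : Realization l r)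

theorem unit_naturality_assoc {k k' : K} (f : k ⟶ k') {Z : FinCoprod H}
    (z : R.functor.obj ((incl G).obj (l.obj k')) ⟶ Z) :
    (incl H).map (r.map f) ≫ R.unit k' ≫ z =
      R.unit k ≫ R.functor.map ((incl G).map (l.map f)) ≫ z := by
  rw [← Category.assoc, R.unit_naturality, Category.assoc]

/-- The coend relation: a morphism of `K` slides from one factor to the other. -/
theorem factor_congr {X : FinCoprod G} {A : H} {k k' : K} (b : A ⟶ r.obj k) (f : k ⟶ k')
    (a : (incl G).obj (l.obj k') ⟶ X) :
    (incl H).map (b ≫ r.map f) ≫ R.unit k' ≫ R.functor.map a =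
      (incl H).map b ≫ R.unit k ≫ R.functor.map ((incl G).map (l.map f) ≫ a) := by
  rw [Functor.map_comp, Category.assoc, R.unit_naturality_assoc, Functor.map_comp]

/-- An epimorphism of families is surjective on indices, so the factor `l k ⟶ Y` of a point lifts
along it. -/
theorem preservesEpimorphisms : R.functor.PreservesEpimorphisms where
  preserves {X Y} f hf := by
    refine epi_of_exists_lift fun A y => ?_
    obtain ⟨k, b, a, rfl⟩ := R.exists_factor y
    obtain ⟨x, rfl⟩ := exists_lift_of_surjective (surjective_of_epi f) a
    exact ⟨(incl H).map b ≫ R.unit k ≫ R.functor.map x, by simp⟩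

/-- Points of the values at `X` and `Y` that agree over `Z` can be written with the same `k` and the
same map `A ⟶ r k`, after which the pullback in families applies to the other factor. -/
theorem map_isPullback {Q X Y Z : FinCoprod G} {fst : Q ⟶ X} {snd : Q ⟶ Y} {f : X ⟶ Z} {g : Y ⟶ Z}
    (h : IsPullback fst snd f g) : IsPullback (R.functor.map fst) (R.functor.map snd)
      (R.functor.map f) (R.functor.map g) := by
  refine isPullback_of_pt (by rw [← Functor.map_comp, h.w, Functor.map_comp])
    (fun A x y hxy => ?_) (fun A p q h₁ h₂ => ?_)
  · obtain ⟨k, b, a, rfl⟩ := R.exists_factor x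
    obtain ⟨k', b', a', rfl⟩ := R.exists_factor y
    simp only [Category.assoc, ← Functor.map_comp] at hxy
    obtain ⟨s, hs, rfl⟩ := R.factor_unique _ _ _ _ hxy
    rw [← Category.assoc] at hs
    refine ⟨(incl H).map b ≫ R.unit k ≫ R.functor.map (h.lift _ _ hs.symm), ?_, ?_⟩
    · simp only [Category.assoc, ← Functor.map_comp, h.lift_fst]
    · simp only [Category.assoc, ← Functor.map_comp, h.lift_snd]
      exact (R.factor_congr _ _ _).symm
  · obtain ⟨k, b, a, rfl⟩ := R.exists_factor p
    obtain ⟨k', b', a', rfl⟩ := R.exists_factor q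
    simp only [Category.assoc, ← Functor.map_comp] at h₁ h₂
    obtain ⟨s, hs, rfl⟩ := R.factor_unique _ _ _ _ h₁
    obtain ⟨t, ht, hst⟩ := R.factor_unique _ _ _ _ h₂
    -- The two projections supply possibly different comparison morphisms `s` and `t`. Their images
    -- in `G` agree because both are compatible with the same point of `Z`, and that is enough.
    have e : l.map t = l.map s := incl_map_comp_injective (a' ≫ fst ≫ f) (by
      have hs' := congrArg (· ≫ f) hs
      have ht' := congrArg (· ≫ g) ht
      simp only [Category.assoc, ← h.w] at hs' ht'
      exact ht'.trans hs'.symm)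
    rw [e] at ht
    rw [R.factor_congr, h.hom_ext (k := a) (l := (incl G).map (l.map s) ≫ a')]
    · rw [← hs, Category.assoc]
    · rw [← ht, Category.assoc]

theorem preservesLimitsOfShape : PreservesLimitsOfShape WalkingCospan R.functor :=
  preservesLimitsOfShape_walkingCospan_of_forall_isPullback fun X Y Z f g _ =>
    ⟨_, _, _, IsPullback.of_hasPullback f g, R.map_isPullback (IsPullback.of_hasPullback f g)⟩

/-- The factor `l k ⟶ X` of a point has a one-member source, so it lies in exactly one summand. -/
theorem preservesFiniteCoproducts : PreservesFiniteCoproducts R.functor := by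
  refine ⟨fun n => ?_⟩
  have (X : Fin n → FinCoprod G) : PreservesColimit (Discrete.functor X) R.functor := by
    refine preservesColimit_of_preserves_colimit_cocone (colimit.isColimit _) ?_
    let c : Cofan X := colimit.cocone (Discrete.functor X)
    have hc : IsColimit c := colimit.isColimit _
    refine (Cofan.isColimitMapCoconeEquiv R.functor X c).symm
      (isColimit_cofan_of_pt _ (fun A x => ?_) (fun A i i' y y' h => ?_)).some
    · obtain ⟨k, b, a, rfl⟩ := R.exists_factor x
      obtain ⟨i, z, rfl⟩ := exists_comp_inj_eq hc a
      exact ⟨i, (incl H).map b ≫ R.unit k ≫ R.functor.map z, by simp⟩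
    · obtain ⟨k, b, a, rfl⟩ := R.exists_factor y
      obtain ⟨k', b', a', rfl⟩ := R.exists_factor y'
      simp only [cofan_mk_inj, Category.assoc, ← Functor.map_comp] at h
      obtain ⟨s, hs, rfl⟩ := R.factor_unique _ _ _ _ h
      rw [← Category.assoc] at hs
      obtain ⟨rfl, e⟩ := exists_of_comp_inj_eq hc hs
      refine ⟨rfl, ?_⟩
      rw [eqToHom_refl, Category.comp_id] at e
      rw [R.factor_congr, e]
      exact Category.comp_id _
  exact preservesColimitsOfShape_of_discrete _

theorem isPce : IsPce R.functor :=
  ⟨R.preservesLimitsOfShape, R.preservesFiniteCoproducts, R.preservesEpimorphisms⟩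

theorem hom_ext {F : FinCoprod G ⥤ FinCoprod H} {α β : R.functor ⟶ F}
    (h : ∀ k, R.unit k ≫ α.app _ = R.unit k ≫ β.app _) : α = β := by
  ext1; ext1 X
  refine hom_ext_pt fun A x => ?_
  obtain ⟨k, b, a, rfl⟩ := R.exists_factor x
  simp only [Category.assoc, NatTrans.naturality]
  rw [← Category.assoc (R.unit k), h, Category.assoc]

/-- The universal property of the coend: the prescribed `ε` determines a value on each factored
point, naturality of `ε` makes it independent of the factorization, and a natural function on points
is a morphism. -/
theorem exists_desc (F : FinCoprod G ⥤ FinCoprod H)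
    (ε : ∀ k, (incl H).obj (r.obj k) ⟶ F.obj ((incl G).obj (l.obj k)))
    (hε : ∀ {k k' : K} (f : k ⟶ k'),
      (incl H).map (r.map f) ≫ ε k' = ε k ≫ F.map ((incl G).map (l.map f))) :
    ∃ α : R.functor ⟶ F, ∀ k, R.unit k ≫ α.app _ = ε k := by
  choose k b a h using @R.exists_factor
  have aux {X : FinCoprod G} {A : H} {k k' : K} (b : A ⟶ r.obj k)
      (a : (incl G).obj (l.obj k) ⟶ X) (b' : A ⟶ r.obj k') (a' : (incl G).obj (l.obj k') ⟶ X)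
      (h : (incl H).map b ≫ R.unit k ≫ R.functor.map a =
        (incl H).map b' ≫ R.unit k' ≫ R.functor.map a') :
      (incl H).map b ≫ ε k ≫ F.map a = (incl H).map b' ≫ ε k' ≫ F.map a' := by
    obtain ⟨f, rfl, rfl⟩ := R.factor_unique _ _ _ _ h
    rw [Functor.map_comp, Functor.map_comp, Category.assoc, ← Category.assoc _ (ε k'), hε]
    simp
  have key (X : FinCoprod G) := exists_hom_of_pt (Y := R.functor.obj X) (T := F.obj X)
    (fun A x => (incl H).map (b x) ≫ ε (k x) ≫ F.map (a x)) (fun {A A'} g x => by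
      conv_rhs => rw [← Category.assoc, ← Functor.map_comp]
      refine aux _ _ _ _ ?_
      rw [h, Functor.map_comp, Category.assoc, h])
  choose α hα using key
  have hα' {X : FinCoprod G} {A : H} {k : K} (b : A ⟶ r.obj k) (a : (incl G).obj (l.obj k) ⟶ X) :
      ((incl H).map b ≫ R.unit k ≫ R.functor.map a) ≫ α X = (incl H).map b ≫ ε k ≫ F.map a := by
    rw [hα]
    exact aux _ _ _ _ (h _)
  refine ⟨{ app := α, naturality := fun X Y f => hom_ext_pt fun A x => ?_ }, fun k => ?_⟩
  · obtain ⟨k, b, a, rfl⟩ := R.exists_factor x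
    have h₁ := hα' b (a ≫ f)
    have h₂ := congrArg (· ≫ F.map f) (hα' b a)
    simp only [Functor.map_comp, Category.assoc] at h₁ h₂ ⊢
    exact h₁.trans h₂.symm
  · simpa using hα' (𝟙 _) (𝟙 ((incl G).obj (l.obj k)))

end

/-! ### Natural transformations induced by span maps -/

section Lift

variable {l : K ⥤ G} {r : K ⥤ H} {l' : K' ⥤ G} {r' : K' ⥤ H} {l'' : K'' ⥤ G} {r'' : K'' ⥤ H}

/-- Compatibility of a natural transformation between realizations with a map of spans. -/
def IsLift (R : Realization l r) (R' : Realization l' r') (m : SpanMap l r l' r')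
    (α : R.functor ⟶ R'.functor) : Prop :=
  ∀ k, R.unit k ≫ α.app _ ≫ R'.functor.map ((incl G).map (m.left k)) =
    (incl H).map (m.right k) ≫ R'.unit (m.functor.obj k)

variable {R : Realization l r} {R' : Realization l' r'} {R'' : Realization l'' r''}

theorem IsLift.congr {m n : SpanMap l r l' r'} {α : R.functor ⟶ R'.functor}
    (h : IsLift R R' m α) (hmn : m.Rel n) : IsLift R R' n α := by
  obtain ⟨θ, h₁, h₂⟩ := hmn
  intro k
  rw [← h₁, ← h₂, Functor.map_comp, Functor.map_comp, Functor.map_comp, Category.assoc,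
    R'.unit_naturality, ← Category.assoc _ (R'.unit _), ← h k]
  simp

/-- The left components of `m` are invertible, so compatibility fixes the transformation on the
unit. -/
theorem IsLift.unique {m : SpanMap l r l' r'} {α β : R.functor ⟶ R'.functor}
    (h : IsLift R R' m α) (h' : IsLift R R' m β) : α = β := by
  refine R.hom_ext fun k => ?_
  rw [← cancel_mono (R'.functor.map ((incl G).map (m.left k))), Category.assoc, Category.assoc,
    h k, h' k]

-- Solving the compatibility equation for the values on the unit, by inverting the left components
-- of `m`, gives natural data to which `exists_desc` applies.
variable (R R') in
theorem exists_isLift (m : SpanMap l r l' r') : ∃ α, IsLift R R' m α := by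
  obtain ⟨α, hα⟩ := R.exists_desc R'.functor (fun k => (incl H).map (m.right k) ≫
    R'.unit (m.functor.obj k) ≫ R'.functor.map (inv ((incl G).map (m.left k))))
    (fun {k k'} f => by
      rw [← cancel_mono (R'.functor.map ((incl G).map (m.left k')))]
      simp only [Category.assoc, ← Functor.map_comp, IsIso.inv_hom_id, m.left_naturality]
      simp only [Functor.map_comp, IsIso.inv_hom_id_assoc, ← R'.unit_naturality]
      simp only [← Category.assoc, ← Functor.map_comp, m.right_naturality]
      simp)
  refine ⟨α, fun k => ?_⟩
  rw [← Category.assoc, hα]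
  simp

theorem IsLift.id : IsLift R R (.id l r) (𝟙 _) := fun k => by simp

theorem IsLift.comp {m : SpanMap l r l' r'} {n : SpanMap l' r' l'' r''}
    {α : R.functor ⟶ R'.functor} {β : R'.functor ⟶ R''.functor}
    (h : IsLift R R' m α) (h' : IsLift R' R'' n β) : IsLift R R'' (m.comp n) (α ≫ β) := by
  intro k
  have e := congrArg (· ≫ β.app _ ≫ R''.functor.map ((incl G).map (n.left _))) (h k)
  simp only [Category.assoc, h' (m.functor.obj k)] at e
  simpa using e

end Lift

variable (G) in
/-- The identity functor realizes the identity span. -/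
def identity : Realization (𝟭 G) (𝟭 G) where
  functor := 𝟭 _
  unit k := 𝟙 _
  unit_naturality f := by simp
  exists_factor {X A} x := ⟨A, 𝟙 A, x, by simp⟩
  factor_unique {X A k k'} b a b' a' h := by
    simp only [Functor.id_obj, Functor.id_map, Category.id_comp] at h
    refine ⟨inv b ≫ b', ?_, by simp⟩
    simp [← h]

/-! ### Composites of realizations and their structural isomorphisms -/

section Comp

variable {l : K ⥤ G} {r : K ⥤ H} {l' : K' ⥤ G} {r' : K' ⥤ H}
  {p : L ⥤ H} {q : L ⥤ M} {p' : L' ⥤ H} {q' : L' ⥤ M} {s : P ⥤ M} {t : P ⥤ N}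

/-- The composite of realizations realizes the composite of spans by homotopy pullback. -/
def comp (R : Realization l r) (T : Realization p q) :
    Realization (SpanMap.fstLeg l r p) (SpanMap.sndLeg r p q) where
  functor := R.functor ⋙ T.functor
  unit x := T.unit x.right ≫ T.functor.map ((incl H).map (inv x.hom) ≫ R.unit x.left)
  unit_naturality {x x'} f := by
    have w : p.map f.right ≫ inv x'.hom = inv x.hom ≫ r.map f.left := by
      rw [IsIso.comp_inv_eq, Category.assoc, IsIso.eq_inv_comp]
      exact f.w.symm
    have w' := congrArg (incl H).map w
    simp only [Functor.map_comp] at w'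
    show (incl M).map (q.map f.right) ≫ T.unit x'.right ≫
        T.functor.map ((incl H).map (inv x'.hom) ≫ R.unit x'.left) =
      (T.unit x.right ≫ T.functor.map ((incl H).map (inv x.hom) ≫ R.unit x.left)) ≫
        T.functor.map (R.functor.map ((incl G).map (l.map f.left)))
    rw [T.unit_naturality_assoc, ← T.functor.map_comp, ← Category.assoc, w', Category.assoc,
      Category.assoc, ← T.functor.map_comp, Category.assoc, R.unit_naturality]
  exists_factor {X A} x := by
    obtain ⟨k, b, a, rfl⟩ := T.exists_factor x
    obtain ⟨k', b', a', rfl⟩ := R.exists_factor a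
    -- Factoring first through `T` and then through `R` gives `b' : p k ⟶ r k'`; an object of the
    -- comma category needs the opposite direction.
    refine ⟨⟨k', k, inv b'⟩, b, a', ?_⟩
    simp
  factor_unique {X A x x'} b a b' a' h := by
    simp only [Functor.comp_map, Category.assoc, ← Functor.map_comp] at h
    obtain ⟨f, hf, hf'⟩ := T.factor_unique _ _ _ _ h
    rw [← Category.assoc, ← Functor.map_comp] at hf
    obtain ⟨g, rfl, hg⟩ := R.factor_unique _ _ _ _ hf.symm
    exact ⟨{ left := g, right := f, w := (IsIso.inv_comp_eq _).1 ((Category.assoc _ _ _).symm.trans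
      ((IsIso.eq_comp_inv _).1 hg)) }, rfl, hf'⟩

/-- This and the following compatibilities are checked on units. With `IsLift.unique` they identify
the transformations induced by whiskerings, associators and unitors of spans with those of functors.
-/
theorem IsLift.whiskerLeft (R : Realization l r) {T : Realization p q} {T' : Realization p' q'}
    {m : SpanMap p q p' q'} {α : T.functor ⟶ T'.functor} (h : IsLift T T' m α) :
    IsLift (R.comp T) (R.comp T') (SpanMap.whiskerLeft l r m) (R.functor.whiskerLeft α) := by
  intro x
  show (T.unit x.right ≫ T.functor.map ((incl H).map (inv x.hom) ≫ R.unit x.left)) ≫ α.app _ ≫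
      T'.functor.map (R.functor.map ((incl G).map (𝟙 (l.obj x.left)))) =
    (incl M).map (m.right x.right) ≫ T'.unit (m.functor.obj x.right) ≫
      T'.functor.map ((incl H).map (inv (x.hom ≫ m.left x.right)) ≫ R.unit x.left)
  have := congrArg (· ≫ T'.functor.map ((incl H).map (inv (x.hom ≫ m.left x.right)) ≫
    R.unit x.left)) (h x.right)
  simp only [Category.assoc] at this
  rw [← this, Category.assoc, α.naturality_assoc]
  simp

theorem IsLift.whiskerRight {R : Realization l r} {R' : Realization l' r'} (T : Realization p q)
    {m : SpanMap l r l' r'} {α : R.functor ⟶ R'.functor} (h : IsLift R R' m α) :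
    IsLift (R.comp T) (R'.comp T) (SpanMap.whiskerRight p q m)
      (Functor.whiskerRight α T.functor) := by
  intro x
  show (T.unit x.right ≫ T.functor.map ((incl H).map (inv x.hom) ≫ R.unit x.left)) ≫
      T.functor.map (α.app _) ≫ T.functor.map (R'.functor.map ((incl G).map (m.left x.left))) =
    (incl M).map (𝟙 (q.obj x.right)) ≫ T.unit x.right ≫
      T.functor.map ((incl H).map (inv (inv (m.right x.left) ≫ x.hom)) ≫
        R'.unit (m.functor.obj x.left))
  have := h x.left
  simp only [← Functor.map_comp, Category.assoc, this]
  simp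

theorem IsLift.associator (R : Realization l r) (T : Realization p q) (U : Realization s t) :
    IsLift ((R.comp T).comp U) (R.comp (T.comp U)) (SpanMap.associator l r p q s t)
      (Functor.associator R.functor T.functor U.functor).hom := by
  intro x
  show (U.unit x.right ≫ U.functor.map ((incl M).map (inv x.hom) ≫ T.unit x.left.right ≫
      T.functor.map ((incl H).map (inv x.left.hom) ≫ R.unit x.left.left))) ≫
        𝟙 _ ≫ U.functor.map (T.functor.map (R.functor.map ((incl G).map (𝟙 _)))) =
    (incl N).map (𝟙 _) ≫ (U.unit x.right ≫
      U.functor.map ((incl M).map (inv x.hom) ≫ T.unit x.left.right)) ≫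
        U.functor.map (T.functor.map ((incl H).map (inv x.left.hom) ≫ R.unit x.left.left))
  simp

theorem IsLift.leftUnitor (R : Realization l r) :
    IsLift ((identity G).comp R) R (SpanMap.leftUnitor l r) R.functor.leftUnitor.hom := by
  intro x
  show (R.unit x.right ≫ R.functor.map ((incl G).map (inv x.hom) ≫ 𝟙 _)) ≫ 𝟙 _ ≫
    R.functor.map ((incl G).map x.hom) = (incl H).map (𝟙 _) ≫ R.unit x.right
  simp

theorem IsLift.rightUnitor (R : Realization l r) :
    IsLift (R.comp (identity H)) R (SpanMap.rightUnitor l r) R.functor.rightUnitor.hom := by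
  intro x
  show (𝟙 ((incl H).obj x.right) ≫ (incl H).map (inv x.hom) ≫ R.unit x.left) ≫ 𝟙 _ ≫
    R.functor.map ((incl G).map (𝟙 _)) = (incl H).map (inv x.hom) ≫ R.unit x.left
  simp

end Comp

end Realization

end

section

variable {G H K K' : Type u}
  [Groupoid.{u} G] [Groupoid.{u} H] [Groupoid.{u} K] [Groupoid.{u} K']

/-- Two parallel morphisms with the same image are lifts of that image with the same source. -/
theorem IsDiscreteFibration.map_injective {p : K ⥤ G} (hp : IsDiscreteFibration p) {k k' : K}
    {f g : k ⟶ k'} (h : p.map f = p.map g) : f = g := by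
  have := (hp k ⟨p.obj k', p.map g⟩).unique (y₁ := ⟨k', f⟩) (y₂ := ⟨k', g⟩) (by rw [h]) rfl
  simpa using this

namespace Realization

/-! ### Transformations between realizations come from unique 2-cells -/

section FullyFaithful

variable {l : K ⥤ G} {r : K ⥤ H} {l' : K' ⥤ G} {r' : K' ⥤ H}
  {R : Realization l r} {R' : Realization l' r'}

/-- Factoring the image of each unit under `α` through `R'` yields an object of `K'` with its two
comparison maps. Uniqueness of factorizations up to a morphism of `K'` supplies the action on
morphisms, and faithfulness of `l'` makes the choices functorial. -/
theorem exists_spanMap (hl' : IsDiscreteFibration l') (α : R.functor ⟶ R'.functor) :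
    ∃ m : SpanMap l r l' r', IsLift R R' m α := by
  have h (k : K) : ∃ (k' : K') (b : r.obj k ⟶ r'.obj k') (a : l'.obj k' ⟶ l.obj k),
      (incl H).map b ≫ R'.unit k' ≫ R'.functor.map ((incl G).map a) = R.unit k ≫ α.app _ := by
    obtain ⟨k', b, a, h⟩ := R'.exists_factor (R.unit k ≫ α.app _)
    exact ⟨k', b, component a, h⟩
  choose k' b a h using h
  have h' {k₁ k₂ : K} (f : k₁ ⟶ k₂) : ∃ s : k' k₁ ⟶ k' k₂,
      l'.map s ≫ a k₂ = a k₁ ≫ l.map f ∧ b k₁ ≫ r'.map s = r.map f ≫ b k₂ := by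
    obtain ⟨s, hs, hs'⟩ := R'.factor_unique (b k₁) ((incl G).map (a k₁ ≫ l.map f))
      (r.map f ≫ b k₂) ((incl G).map (a k₂)) (by
        have e := R.unit_naturality_assoc f (α.app _)
        rw [α.naturality, ← h, ← Category.assoc (R.unit k₁), ← h] at e
        simp only [Functor.map_comp, Category.assoc] at e ⊢
        exact e.symm)
    rw [← Functor.map_comp] at hs
    exact ⟨s, incl_map_injective hs, hs'⟩
  choose s hs hs' using @h'
  -- The left square alone determines `s`, since `a k₂` is invertible and `l'` is faithful.
  have key {k₁ k₂ : K} {t t' : k' k₁ ⟶ k' k₂} (e : l'.map t ≫ a k₂ = l'.map t' ≫ a k₂) : t = t' :=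
    hl'.map_injective ((cancel_mono _).1 e)
  let φ : K ⥤ K' :=
    { obj := k'
      map := s
      map_id := fun k => key (by simp [hs])
      map_comp := fun f g => key (by
        rw [hs, Functor.map_comp, Functor.map_comp, Category.assoc, hs, reassoc_of% hs]) }
  have hl {k₁ k₂ : K} (f : k₁ ⟶ k₂) :
      l.map f ≫ inv (a k₂) = inv (a k₁) ≫ l'.map (φ.map f) := by
    rw [IsIso.comp_inv_eq, Category.assoc, IsIso.eq_inv_comp]
    exact (hs f).symm
  refine ⟨⟨φ, fun k => inv (a k), b, hl, fun f => (hs' f).symm⟩, fun k => ?_⟩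
  show R.unit k ≫ α.app _ ≫ R'.functor.map ((incl G).map (inv (a k))) =
    (incl H).map (b k) ≫ R'.unit (k' k)
  rw [← Category.assoc, ← h]
  simp

/-- Both span maps factor the same point, so `factor_unique` gives the components of the comparison;
its naturality can be checked after applying the faithful `l'`. -/
theorem rel_of_isLift (hl' : IsDiscreteFibration l') {m n : SpanMap l r l' r'}
    {α : R.functor ⟶ R'.functor} (hm : IsLift R R' m α) (hn : IsLift R R' n α) : m.Rel n := by
  have key {m : SpanMap l r l' r'} (hm : IsLift R R' m α) (k : K) :
      (incl H).map (m.right k) ≫ R'.unit _ ≫ R'.functor.map ((incl G).map (inv (m.left k))) =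
        R.unit k ≫ α.app _ := by
    rw [← Category.assoc, ← hm k]
    simp
  have h (k : K) : ∃ θ : m.functor.obj k ⟶ n.functor.obj k,
      m.left k ≫ l'.map θ = n.left k ∧ m.right k ≫ r'.map θ = n.right k := by
    obtain ⟨θ, h₁, h₂⟩ := R'.factor_unique _ _ _ _ ((key hm k).trans (key hn k).symm)
    rw [← Functor.map_comp] at h₁
    have h₃ : l'.map θ ≫ inv (n.left k) = inv (m.left k) := incl_map_injective h₁
    exact ⟨θ, (IsIso.eq_inv_comp _).1 ((IsIso.comp_inv_eq _).1 h₃), h₂⟩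
  choose θ h₁ h₂ using h
  refine ⟨{ app := θ, naturality := fun k k' f => hl'.map_injective ?_ }, h₁, h₂⟩
  rw [← cancel_epi (m.left k), Functor.map_comp, Functor.map_comp, ← m.left_naturality_assoc, h₁,
    ← Category.assoc, h₁, n.left_naturality]

end FullyFaithful

/-! ### Existence of realizations for discrete fibrations -/

section Existence

variable {l : K ⥤ G} {r : K ⥤ H}

/-- A realization can be constructed objectwise. -/
theorem exists_of_objectwise (obj : FinCoprod G → FinCoprod H)
    (u : ∀ (X : FinCoprod G) (k : K), ((incl G).obj (l.obj k) ⟶ X) →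
      ((incl H).obj (r.obj k) ⟶ obj X))
    (hu : ∀ (X : FinCoprod G) {k k' : K} (f : k ⟶ k') (a : (incl G).obj (l.obj k') ⟶ X),
      (incl H).map (r.map f) ≫ u X k' a = u X k ((incl G).map (l.map f) ≫ a))
    (exists_factor : ∀ {X : FinCoprod G} {A : H} (x : (incl H).obj A ⟶ obj X),
      ∃ (k : K) (b : A ⟶ r.obj k) (a : (incl G).obj (l.obj k) ⟶ X), (incl H).map b ≫ u X k a = x)
    (factor_unique : ∀ {X : FinCoprod G} {A : H} {k k' : K} (b : A ⟶ r.obj k)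
      (a : (incl G).obj (l.obj k) ⟶ X) (b' : A ⟶ r.obj k') (a' : (incl G).obj (l.obj k') ⟶ X),
      (incl H).map b ≫ u X k a = (incl H).map b' ≫ u X k' a' →
        ∃ f : k ⟶ k', (incl G).map (l.map f) ≫ a' = a ∧ b ≫ r.map f = b') :
    Nonempty (Realization l r) := by
  -- The action on morphisms is forced on the points `u X k a`, which generate all points;
  -- functoriality then follows from the uniqueness in `ext`.
  have map {X Y : FinCoprod G} (f : X ⟶ Y) : ∃ g : obj X ⟶ obj Y,
      ∀ (k : K) (a : (incl G).obj (l.obj k) ⟶ X), u X k a ≫ g = u Y k (a ≫ f) := by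
    choose k b a h using @exists_factor X
    have aux {A : H} {k k' : K} (b : A ⟶ r.obj k) (a : (incl G).obj (l.obj k) ⟶ X)
        (b' : A ⟶ r.obj k') (a' : (incl G).obj (l.obj k') ⟶ X)
        (h : (incl H).map b ≫ u X k a = (incl H).map b' ≫ u X k' a') :
        (incl H).map b ≫ u Y k (a ≫ f) = (incl H).map b' ≫ u Y k' (a' ≫ f) := by
      obtain ⟨s, rfl, rfl⟩ := factor_unique _ _ _ _ h
      rw [Functor.map_comp, Category.assoc, Category.assoc, hu]
    obtain ⟨g, hg⟩ := exists_hom_of_pt (Y := obj X) (T := obj Y)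
      (fun A x => (incl H).map (b x) ≫ u Y (k x) (a x ≫ f)) (fun {A A'} t x => by
        rw [← Category.assoc, ← Functor.map_comp]
        refine aux _ _ _ _ ?_
        rw [h, Functor.map_comp, Category.assoc, h])
    refine ⟨g, fun k a => ?_⟩
    rw [hg]
    simpa using aux _ _ (𝟙 _) a ((h _).trans (by simp))
  have ext {X Y : FinCoprod G} {g g' : obj X ⟶ obj Y} (h : ∀ k a, u X k a ≫ g = u X k a ≫ g') :
      g = g' := by
    refine hom_ext_pt fun A x => ?_
    obtain ⟨k, b, a, rfl⟩ := exists_factor x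
    rw [Category.assoc, Category.assoc, h]
  choose map hmap using @map
  have hmap' {X : FinCoprod G} {k : K} (a : (incl G).obj (l.obj k) ⟶ X) :
      u _ k (𝟙 _) ≫ map a = u X k a := by rw [hmap, Category.id_comp]
  exact ⟨{ functor :=
            { obj := obj
              map := map
              map_id := fun X => ext fun k a => by rw [hmap, Category.comp_id, Category.comp_id]
              map_comp := fun f g => ext fun k a => by
                rw [hmap, ← Category.assoc, ← Category.assoc, hmap, hmap] }
           unit := fun k => u _ k (𝟙 _)
           unit_naturality := fun f => by rw [hu, hmap', Category.comp_id]
           exists_factor := fun x => by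
            obtain ⟨k, b, a, h⟩ := exists_factor x
            exact ⟨k, b, a, by rw [hmap', h]⟩
           factor_unique := fun b a b' a' h => factor_unique b a b' a' (by
            rwa [hmap', hmap'] at h) }⟩

/-- The objects of the fibres of `l` over the members of a family. -/
abbrev FibreIndex (l : K ⥤ G) (X : FinCoprod G) : Type u :=
  Σ i : X.obj.I, { k : K // l.obj k = X.obj.obj i }

/-- The family of the values of `r` on the fibres of `l` over the members of a family. -/
def fibre [Finite K] (l : K ⥤ G) (r : K ⥤ H) (X : FinCoprod G) : FinCoprod H :=
  ⟨⟨FibreIndex l X, fun p => r.obj p.2.1⟩,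
    have : Finite X.obj.I := X.property
    inferInstanceAs (Finite (FibreIndex l X))⟩

/-- The map to `X` given by an object of a fibre over `X`. -/
def fibrePt (l : K ⥤ G) (X : FinCoprod G) (j : FibreIndex l X) : (incl G).obj (l.obj j.2.1) ⟶ X :=
  pt X j.1 (eqToHom j.2.2)

/-- Lift the component of `a` along `l`: the endpoint is an object of the fibre. Together with
`fibrePt_unique` this identifies maps `l k ⟶ X` with morphisms from `k` to fibre objects. -/
theorem exists_fibrePt (hl : IsDiscreteFibration l) {X : FinCoprod G} {k : K}
    (a : (incl G).obj (l.obj k) ⟶ X) : ∃ p : Σ j : FibreIndex l X, k ⟶ j.2.1,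
      (incl G).map (l.map p.2) ≫ fibrePt l X p.1 = a := by
  obtain ⟨⟨k', g⟩, hg, -⟩ := hl k ⟨_, component a⟩
  obtain ⟨h, hg⟩ := (strictPullback.sigma_eq_iff _ _).1 hg
  exact ⟨⟨⟨idx a, k', h⟩, g⟩, congrArg (pt X (idx a)) hg⟩

theorem fibrePt_unique (hl : IsDiscreteFibration l) {X : FinCoprod G} {k : K}
    {p q : Σ j : FibreIndex l X, k ⟶ j.2.1}
    (h : (incl G).map (l.map p.2) ≫ fibrePt l X p.1 =
      (incl G).map (l.map q.2) ≫ fibrePt l X q.1) : p = q := by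
  obtain ⟨⟨i, k₁, h₁⟩, g₁⟩ := p
  obtain ⟨⟨i', k₂, h₂⟩, g₂⟩ := q
  obtain rfl : i = i' := congrArg idx h
  have e : l.map g₁ ≫ eqToHom h₁ = l.map g₂ ≫ eqToHom h₂ :=
    (Category.comp_id _).symm.trans (component_congr h)
  have := (hl k ⟨_, l.map g₂ ≫ eqToHom h₂⟩).unique (y₁ := ⟨k₁, g₁⟩) (y₂ := ⟨k₂, g₂⟩)
    ((strictPullback.sigma_eq_iff _ _).2 ⟨h₁, e⟩) ((strictPullback.sigma_eq_iff _ _).2 ⟨h₂, rfl⟩)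
  cases this
  rfl

/-- The map to the fibre over `X` given by a map to one of its objects. -/
def fibreUnit [Finite K] (l : K ⥤ G) (r : K ⥤ H) (X : FinCoprod G) {k : K}
    (p : Σ j : FibreIndex l X, k ⟶ j.2.1) : (incl H).obj (r.obj k) ⟶ fibre l r X :=
  pt (fibre l r X) p.1 (r.map p.2)

theorem incl_map_comp_fibreUnit [Finite K] (X : FinCoprod G) {k k' : K} (f : k ⟶ k')
    (p : Σ j : FibreIndex l X, k' ⟶ j.2.1) :
    (incl H).map (r.map f) ≫ fibreUnit l r X p = fibreUnit l r X ⟨p.1, f ≫ p.2⟩ :=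
  congrArg (pt (fibre l r X) p.1) (r.map_comp f p.2).symm

theorem exists_of_comp_fibreUnit_eq [Finite K] {X : FinCoprod G} {A : H} {k k' : K}
    {p : Σ j : FibreIndex l X, k ⟶ j.2.1} {p' : Σ j : FibreIndex l X, k' ⟶ j.2.1}
    {b : A ⟶ r.obj k} {b' : A ⟶ r.obj k'}
    (h : (incl H).map b ≫ fibreUnit l r X p = (incl H).map b' ≫ fibreUnit l r X p') :
    ∃ f : k ⟶ k', (incl G).map (l.map f) ≫ (incl G).map (l.map p'.2) ≫ fibrePt l X p'.1 =
      (incl G).map (l.map p.2) ≫ fibrePt l X p.1 ∧ b ≫ r.map f = b' := by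
  obtain ⟨j, g⟩ := p
  obtain ⟨j', g'⟩ := p'
  obtain rfl : j = j' := congrArg idx h
  have e : b ≫ r.map g = b' ≫ r.map g' := (Category.comp_id _).symm.trans (component_congr h)
  refine ⟨g ≫ inv g', ?_, ?_⟩
  · simp
  · rw [Functor.map_comp, ← Category.assoc, e]
    simp

/-- As a functor of `k`, the maps `l k ⟶ X` are a sum of representables indexed by the fibre
objects, so the coend consists of the points of `fibre l r X`. -/
theorem exists_of_isDiscreteFibration [Finite K] (hl : IsDiscreteFibration l) :
    Nonempty (Realization l r) := by
  choose p hp using fun (X : FinCoprod G) (k : K) (a : (incl G).obj (l.obj k) ⟶ X) =>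
    exists_fibrePt hl a
  refine exists_of_objectwise (fibre l r) (fun X k a => fibreUnit l r X (p X k a))
    (fun X k k' f a => ?_) (fun {X A} x => ?_) (fun {X A k k'} b a b' a' h => ?_)
  · rw [incl_map_comp_fibreUnit]
    congr 1
    exact fibrePt_unique hl (by rw [hp, Functor.map_comp, Functor.map_comp, Category.assoc, hp])
  · let j : FibreIndex l X := idx x
    -- By uniqueness, the chosen lift of the canonical point at a fibre object is the identity.
    have : p X _ (fibrePt l X j) = ⟨j, 𝟙 _⟩ := fibrePt_unique hl (by rw [hp]; simp)
    let b : A ⟶ r.obj j.2.1 := component x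
    refine ⟨_, b, fibrePt l X j, ?_⟩
    rw [this]
    exact congrArg (pt (fibre l r X) j) (show b ≫ r.map (𝟙 _) = b by simp)
  · obtain ⟨f, hf, hf'⟩ := exists_of_comp_fibreUnit_eq h
    rw [hp, hp] at hf
    exact ⟨f, hf, hf'⟩

end Existence

end Realization

/-! ### The span of members of a functor -/

section OfPce

variable (F : FinCoprod G ⥤ FinCoprod H)

/-- The groupoid of members of the values of a functor on one-member families. -/
structure Member where
  base : G
  index : (F.obj ((incl G).obj base)).obj.I

namespace Member

variable {F}

/-- The map from the one-member family given by a member. -/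
def unit (x : Member F) : (incl H).obj ((F.obj ((incl G).obj x.base)).obj.obj x.index) ⟶
    F.obj ((incl G).obj x.base) :=
  pt _ x.index (𝟙 _)

/-- This is the category of elements of the functor sending `X` to the index set of `F` at the
one-member family `X`, which is why its projection to `G` is a discrete fibration. -/
instance : Groupoid.{u} (Member F) where
  Hom x y := { a : x.base ⟶ y.base // idx (x.unit ≫ F.map ((incl G).map a)) = y.index }
  id x := ⟨𝟙 x.base, by simp [unit]⟩
  comp {x y z} a b := ⟨a.1 ≫ b.1, by
    have : idx (x.unit ≫ F.map ((incl G).map (a.1 ≫ b.1))) = (F.map ((incl G).map b.1)).hom.f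
        (idx (x.unit ≫ F.map ((incl G).map a.1))) := by
      rw [Functor.map_comp, Functor.map_comp]
      rfl
    exact this.trans ((congrArg _ a.2).trans b.2)⟩
  id_comp _ := Subtype.ext (Category.id_comp _)
  comp_id _ := Subtype.ext (Category.comp_id _)
  assoc _ _ _ := Subtype.ext (Category.assoc _ _ _)
  inv {x y} a := ⟨inv a.1, by
    have : idx ((x.unit ≫ F.map ((incl G).map a.1)) ≫ F.map ((incl G).map (inv a.1))) =
        x.index := by
      rw [Category.assoc, ← Functor.map_comp, ← Functor.map_comp, IsIso.hom_inv_id]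
      simp [unit]
    exact (congrArg (F.map ((incl G).map (inv a.1))).hom.f a.2.symm).trans this⟩
  inv_comp _ := Subtype.ext (IsIso.inv_hom_id _)
  comp_inv _ := Subtype.ext (IsIso.hom_inv_id _)

variable (F)

instance [Finite G] : Finite (Member F) :=
  have (X : G) : Finite (F.obj ((incl G).obj X)).obj.I := (F.obj _).property
  Finite.of_injective (fun x : Member F => (⟨x.base, x.index⟩ :
    Σ X : G, (F.obj ((incl G).obj X)).obj.I)) (by rintro ⟨⟩ ⟨⟩ h; cases h; rfl)

instance [∀ X Y : G, Finite (X ⟶ Y)] (x y : Member F) : Finite (x ⟶ y) :=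
  inferInstanceAs (Finite { a : x.base ⟶ y.base // _ })

/-- The projection of the groupoid of members. -/
def left : Member F ⥤ G where
  obj x := x.base
  map a := a.1

theorem sigma_hom_eq (x : Member F) {Y : G} {j : (F.obj ((incl G).obj Y)).obj.I} (a : x.base ⟶ Y)
    (ha : idx (x.unit ≫ F.map ((incl G).map a)) = j) :
    (⟨⟨Y, j⟩, ⟨a, ha⟩⟩ : Σ y : Member F, x ⟶ y) =
      ⟨⟨Y, idx (x.unit ≫ F.map ((incl G).map a))⟩, ⟨a, rfl⟩⟩ := by
  subst ha
  rfl

theorem left_isDiscreteFibration : IsDiscreteFibration (left F) := by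
  rintro x ⟨Y, f⟩
  refine ⟨⟨⟨Y, idx (x.unit ≫ F.map ((incl G).map f))⟩, ⟨f, rfl⟩⟩, rfl, ?_⟩
  rintro ⟨⟨Y', j⟩, ⟨a, ha⟩⟩ h
  cases h
  exact sigma_hom_eq F x a ha

/-- Both points of the target have index `y.index`. The morphism is unique by
`incl_map_comp_injective`, so choosing it is functorial. -/
theorem exists_right {x y : Member F} (a : x ⟶ y) :
    ∃ g : (F.obj ((incl G).obj x.base)).obj.obj x.index ⟶
        (F.obj ((incl G).obj y.base)).obj.obj y.index,
      (incl H).map g ≫ y.unit = x.unit ≫ F.map ((incl G).map a.1) :=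
  exists_of_idx_eq _ _ a.2

/-- The value of a member. -/
def right : Member F ⥤ H where
  obj x := (F.obj ((incl G).obj x.base)).obj.obj x.index
  map a := (exists_right F a).choose
  map_id x := incl_map_comp_injective x.unit (by
    rw [(exists_right F (𝟙 x)).choose_spec]
    show x.unit ≫ F.map ((incl G).map (𝟙 x.base)) = _
    simp)
  map_comp {x y z} a b := incl_map_comp_injective z.unit (by
    rw [(exists_right F (a ≫ b)).choose_spec, Functor.map_comp, Category.assoc,
      (exists_right F b).choose_spec, ← Category.assoc, (exists_right F a).choose_spec]
    show x.unit ≫ F.map ((incl G).map (a.1 ≫ b.1)) = _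
    simp)

/-- The map from the one-member family given by a member, as a map from the value of the member. -/
def rightUnit (x : Member F) :
    (incl H).obj ((right F).obj x) ⟶ F.obj ((incl G).obj ((left F).obj x)) :=
  x.unit

theorem rightUnit_naturality {x y : Member F} (a : x ⟶ y) :
    (incl H).map ((right F).map a) ≫ rightUnit F y =
      rightUnit F x ≫ F.map ((incl G).map ((left F).map a)) :=
  (exists_right F a).choose_spec

end Member

namespace FinCoprod

theorem exists_isColimit_incl (X : FinCoprod G) : ∃ (n : ℕ) (e : Fin n ≃ X.obj.I),
    Nonempty (IsColimit (Cofan.mk X fun j => pt X (e j) (𝟙 (X.obj.obj (e j))))) := by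
  have : Finite X.obj.I := X.property
  obtain ⟨n, ⟨e⟩⟩ := Finite.exists_equiv_fin X.obj.I
  refine ⟨n, e.symm, isColimit_cofan_of_pt _ (fun A x => ?_) (fun A i i' y y' h => ?_)⟩
  · obtain ⟨g, hg⟩ := exists_of_idx_eq x (pt X (e.symm (e (idx x))) (𝟙 _)) (by simp)
    exact ⟨e (idx x), (incl G).map g, hg⟩
  · have h' : idx (y ≫ pt X (e.symm i) (𝟙 _)) = idx (y' ≫ pt X (e.symm i') (𝟙 _)) :=
      congrArg idx h
    obtain rfl : i = i' := e.symm.injective h'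
    refine ⟨rfl, ?_⟩
    have : component y = component y' :=
      incl_map_comp_injective (pt X (e.symm i) (𝟙 _)) h
    exact (Category.comp_id _).trans (congrArg (incl G).map this)

/-- Maps into a one-member family differ only in their components, and the component of `a` is
invertible. -/
instance {A : G} {X : FinCoprod G} (a : (incl G).obj A ⟶ X) : Mono a where
  right_cancellation f g h := hom_ext_pt fun B y => by
    have : component (y ≫ f) = component (y ≫ g) := incl_map_comp_injective a (by
      show (y ≫ f) ≫ a = (y ≫ g) ≫ a
      rw [Category.assoc, h, Category.assoc])
    exact congrArg (incl G).map this

end FinCoprod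

/-- A functor which preserves pullbacks and finite coproducts realizes its span of members. -/
def Realization.ofIsPce {F : FinCoprod G ⥤ FinCoprod H} (hF : IsPce F) :
    Realization (Member.left F) (Member.right F) where
  functor := F
  unit x := Member.rightUnit F x
  unit_naturality a := Member.rightUnit_naturality F a
  exists_factor {X A} x := by
    have := hF.2.1
    -- Since `F` preserves the decomposition of `X` into its members, a point of `F.obj X` comes
    -- from the value at a single member.
    obtain ⟨n, e, ⟨hc⟩⟩ := exists_isColimit_incl X
    obtain ⟨i, y, hy⟩ := exists_comp_inj_eq (Cofan.isColimitMapCoconeEquiv F _ _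
      (isColimitOfPreserves F hc)) x
    have : y = (incl H).map (component y) ≫ pt _ (idx y) (𝟙 _) := by
      rw [incl_map_comp_pt, Category.comp_id]; rfl
    refine ⟨⟨X.obj.obj (e i), idx y⟩, component y, pt X (e i) (𝟙 _), ?_⟩
    refine Eq.trans ?_ hy
    conv_rhs => rw [this]
    exact (Category.assoc _ _ _).symm
  factor_unique {X A k k'} b a b' a' h := by
    have := hF.1
    have := hF.2.1
    obtain ⟨n, e, ⟨hc⟩⟩ := exists_isColimit_incl X
    -- Disjointness of the summands of `F.obj X` forces `a` and `a'` to hit the same member of `X`.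
    have hi : idx a = idx a' := by
      obtain ⟨i, z, rfl⟩ := exists_comp_inj_eq hc a
      obtain ⟨i', z', rfl⟩ := exists_comp_inj_eq hc a'
      obtain ⟨rfl, -⟩ := exists_of_comp_inj_eq
        (x := (incl H).map b ≫ Member.rightUnit F k ≫ F.map z)
        (x' := (incl H).map b' ≫ Member.rightUnit F k' ≫ F.map z')
        (Cofan.isColimitMapCoconeEquiv F _ _ (isColimitOfPreserves F hc)) (i := i) (i' := i') (by
          simp only [Functor.map_comp] at h
          simpa only [Category.assoc, cofan_mk_inj] using h)
      rfl
    obtain ⟨f, rfl⟩ := exists_of_idx_eq a a' hi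
    have h' : (incl H).map b ≫ Member.rightUnit F k ≫ F.map ((incl G).map f) =
        (incl H).map b' ≫ Member.rightUnit F k' := by
      -- A functor preserving pullbacks preserves the monomorphism `a'`.
      rw [← cancel_mono (F.map a')]
      simpa using h
    let s : k ⟶ k' := ⟨f, congrArg idx h'⟩
    refine ⟨s, rfl, incl_map_comp_injective (Member.rightUnit F k') ?_⟩
    rw [Functor.map_comp, Category.assoc, Member.rightUnit_naturality]
    exact h'

end OfPce

end

/-! ### The action of 2-cells of spans on realizations -/

namespace GpdSpan

variable {G H M N : FinGpd.{u}}

/-- Realizations of a span of finite groupoids. -/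
abbrev Realization (S : GpdSpan G H) := GlobalBurnside.Realization S.left S.right

/-- Quantifying over all representatives of `η` makes the chosen transformation compatible with each
of them. -/
theorem exists_lift {S S' : GpdSpan G H} (η : S ⟶ S') (R : S.Realization) (R' : S'.Realization) :
    ∃ α : R.functor ⟶ R'.functor, ∀ m : S.Map S', Map.toHom m = η → R.IsLift R' m α := by
  obtain ⟨m, rfl⟩ := Map.toHom_surjective η
  obtain ⟨α, h⟩ := Realization.exists_isLift R R' m
  exact ⟨α, fun n hn => h.congr (Quotient.exact hn.symm)⟩

/-- The natural transformation between realizations induced by a 2-cell of spans. -/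
def lift {S S' : GpdSpan G H} (η : S ⟶ S') (R : S.Realization) (R' : S'.Realization) :
    R.functor ⟶ R'.functor :=
  (exists_lift η R R').choose

/-- The composite of realizations, as a realization of the composite span. -/
abbrev Realization.comp {S : GpdSpan G H} {T : GpdSpan H M} (R : S.Realization)
    (Q : T.Realization) : (S.comp T).Realization :=
  GlobalBurnside.Realization.comp R Q

/-- The identity, as a realization of the identity span. -/
abbrev Realization.id (G : FinGpd.{u}) : (identity G).Realization :=
  GlobalBurnside.Realization.identity G

variable {S S' S'' : GpdSpan G H} {T T' : GpdSpan H M} {U : GpdSpan M N}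

theorem isLift_lift (m : S.Map S') (R : S.Realization) (R' : S'.Realization) :
    R.IsLift R' m (lift (Map.toHom m) R R') :=
  (exists_lift (Map.toHom m) R R').choose_spec m rfl

theorem lift_toHom_eq {m : S.Map S'} {R : S.Realization} {R' : S'.Realization}
    {α : R.functor ⟶ R'.functor} (h : R.IsLift R' m α) : lift (Map.toHom m) R R' = α :=
  (isLift_lift m R R').unique h

theorem lift_id (R : S.Realization) : lift (𝟙 S) R R = 𝟙 _ :=
  lift_toHom_eq .id

theorem lift_comp (η : S ⟶ S') (θ : S' ⟶ S'') (R : S.Realization) (R' : S'.Realization)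
    (R'' : S''.Realization) : lift (η ≫ θ) R R'' = lift η R R' ≫ lift θ R' R'' := by
  obtain ⟨m, rfl⟩ := Map.toHom_surjective η
  obtain ⟨n, rfl⟩ := Map.toHom_surjective θ
  exact lift_toHom_eq ((isLift_lift m R R').comp (isLift_lift n R' R''))

theorem lift_whiskerLeft (R : S.Realization) (η : T ⟶ T') (Q : T.Realization)
    (Q' : T'.Realization) : lift (whiskerLeft S η) (Realization.comp R Q) (Realization.comp R Q') =
      R.functor.whiskerLeft (lift η Q Q') := by
  obtain ⟨m, rfl⟩ := Map.toHom_surjective η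
  exact lift_toHom_eq ((isLift_lift m Q Q').whiskerLeft R)

theorem lift_whiskerRight (η : S ⟶ S') (R : S.Realization) (R' : S'.Realization)
    (Q : T.Realization) : lift (whiskerRight η T) (Realization.comp R Q) (Realization.comp R' Q) =
      Functor.whiskerRight (lift η R R') Q.functor := by
  obtain ⟨m, rfl⟩ := Map.toHom_surjective η
  exact lift_toHom_eq ((isLift_lift m R R').whiskerRight Q)

variable {V V' : GpdSpan G M} {W W' : GpdSpan G N} {Z : GpdSpan H N}

/-- In this and the next four lemmas, the composites have the shape of the structure cells of
`SubCells.bicategory`: a cell for homotopy pullbacks conjugated by comparisons with other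
composites. Each one is thus a coherence law of the pseudofunctor. -/
theorem lift_conj_whiskerLeft (i : V ⟶ S.comp T) (η : T ⟶ T') (j : S.comp T' ⟶ V')
    (A : V.Realization) (R : S.Realization) (Q : T.Realization) (Q' : T'.Realization)
    (A' : V'.Realization) : lift (i ≫ whiskerLeft S η ≫ j) A A' =
      lift i A (Realization.comp R Q) ≫ R.functor.whiskerLeft (lift η Q Q') ≫
        lift j (Realization.comp R Q') A' := by
  rw [lift_comp i _ A (Realization.comp R Q) A', lift_comp _ j _ (Realization.comp R Q') A',
    lift_whiskerLeft]
  rfl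

theorem lift_conj_whiskerRight (i : V ⟶ S.comp T) (η : S ⟶ S') (j : S'.comp T ⟶ V')
    (A : V.Realization) (R : S.Realization) (R' : S'.Realization) (Q : T.Realization)
    (A' : V'.Realization) : lift (i ≫ whiskerRight η T ≫ j) A A' =
      lift i A (Realization.comp R Q) ≫ Functor.whiskerRight (lift η R R') Q.functor ≫
        lift j (Realization.comp R' Q) A' := by
  rw [lift_comp i _ A (Realization.comp R Q) A', lift_comp _ j _ (Realization.comp R' Q) A',
    lift_whiskerRight]
  rfl

theorem lift_conj_associator (i : W ⟶ V.comp U) (η : V ⟶ S.comp T) (θ : T.comp U ⟶ Z)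
    (j : S.comp Z ⟶ W') (A : W.Realization) (B : V.Realization) (R : S.Realization)
    (Q : T.Realization) (P : U.Realization) (D : Z.Realization) (A' : W'.Realization) :
    lift (i ≫ whiskerRight η U ≫ (associator S T U).hom ≫ whiskerLeft S θ ≫ j) A A' =
      lift i A (Realization.comp B P) ≫
        Functor.whiskerRight (lift η B (Realization.comp R Q)) P.functor ≫
          (Functor.associator R.functor Q.functor P.functor).hom ≫
            R.functor.whiskerLeft (lift θ (Realization.comp Q P) D) ≫
              lift j (Realization.comp R D) A' := by
  have h : lift (associator S T U).hom (Realization.comp (Realization.comp R Q) P)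
      (Realization.comp R (Realization.comp Q P)) =
        (Functor.associator R.functor Q.functor P.functor).hom :=
    lift_toHom_eq (.associator R Q P)
  rw [lift_comp i _ A (Realization.comp B P) A',
    lift_comp _ _ _ (Realization.comp (Realization.comp R Q) P) A',
    lift_comp _ _ _ (Realization.comp R (Realization.comp Q P)) A',
    lift_comp _ j _ (Realization.comp R D) A', lift_whiskerLeft, lift_whiskerRight, h]
  rfl

theorem lift_conj_leftUnitor {I : GpdSpan G G} (i : S' ⟶ I.comp S) (η : I ⟶ identity G)
    (A : S'.Realization) (B : I.Realization) (R : S.Realization) :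
    lift (i ≫ whiskerRight η S ≫ (leftUnitor S).hom) A R = lift i A (Realization.comp B R) ≫
      Functor.whiskerRight (lift η B (Realization.id G)) R.functor ≫ R.functor.leftUnitor.hom := by
  have h : lift (leftUnitor S).hom (Realization.comp (Realization.id G) R) R =
      R.functor.leftUnitor.hom := lift_toHom_eq (.leftUnitor R)
  rw [lift_comp i _ A (Realization.comp B R) R,
    lift_comp _ _ _ (Realization.comp (Realization.id G) R) R, lift_whiskerRight, h]
  rfl

theorem lift_conj_rightUnitor {I : GpdSpan H H} (i : S' ⟶ S.comp I) (η : I ⟶ identity H)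
    (A : S'.Realization) (B : I.Realization) (R : S.Realization) :
    lift (i ≫ whiskerLeft S η ≫ (rightUnitor S).hom) A R = lift i A (Realization.comp R B) ≫
      R.functor.whiskerLeft (lift η B (Realization.id H)) ≫ R.functor.rightUnitor.hom := by
  have h : lift (rightUnitor S).hom (Realization.comp R (Realization.id H)) R =
      R.functor.rightUnitor.hom := lift_toHom_eq (.rightUnitor R)
  rw [lift_comp i _ A (Realization.comp R B) R,
    lift_comp _ _ _ (Realization.comp R (Realization.id H)) R, lift_whiskerLeft, h]
  rfl

/-- The natural isomorphism between realizations induced by an invertible 2-cell of spans. -/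
def liftIso (i : S ≅ S') (R : S.Realization) (R' : S'.Realization) : R.functor ≅ R'.functor where
  hom := lift i.hom R R'
  inv := lift i.inv R' R
  hom_inv_id := by rw [← lift_comp, i.hom_inv_id, lift_id]
  inv_hom_id := by rw [← lift_comp, i.inv_hom_id, lift_id]

theorem lift_injective (hS' : IsDiscreteFibration S'.left) (R : S.Realization)
    (R' : S'.Realization) {η θ : S ⟶ S'} (h : lift η R R' = lift θ R R') : η = θ := by
  obtain ⟨m, rfl⟩ := Map.toHom_surjective η
  obtain ⟨n, rfl⟩ := Map.toHom_surjective θ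
  have hm := isLift_lift m R R'
  rw [h] at hm
  exact Map.toHom_eq (Realization.rel_of_isLift hS' hm (isLift_lift n R R'))

theorem lift_surjective (hS' : IsDiscreteFibration S'.left) {R : S.Realization}
    {R' : S'.Realization} (α : R.functor ⟶ R'.functor) : ∃ η : S ⟶ S', lift η R R' = α := by
  obtain ⟨m, hm⟩ := Realization.exists_spanMap hS' α
  exact ⟨Map.toHom m, lift_toHom_eq hm⟩

end GpdSpan

/-! ### Chosen realizations and 1-cells of `CogloCat` -/

namespace BurnSpan

variable {G H : FinGpd.{u}}

/-- A realization of a span whose left leg is a discrete fibration. -/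
def realization (S : BurnSpan G H) : S.span.Realization :=
  (Realization.exists_of_isDiscreteFibration S.isDiscreteFibration).some

/-- The span of members of a functor. -/
def ofFunctor (F : FinCoprod G ⥤ FinCoprod H) : BurnSpan G H where
  span :=
    { apex := ⟨Member F⟩
      left := Member.left F
      right := Member.right F }
  isDiscreteFibration := Member.left_isDiscreteFibration F

end BurnSpan

namespace CogloCat

variable {G H : FinGpd.{u}}

/-- The 1-cell given by a functor which preserves pullbacks, finite coproducts, epimorphisms. -/
def ofFunctor (F : FinCoprod G ⥤ FinCoprod H) (hF : IsPce F) : of G ⟶ of H :=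
  Bicategory.InducedBicategory.mkHom (⟨F, hF⟩ : CatPce.Fun (CatPce.free G) (CatPce.free H))

/-- The functor underlying a 1-cell. -/
def toFunctor (F : of G ⟶ of H) : FinCoprod G ⥤ FinCoprod H := F.hom.obj

theorem toFunctor_isPce (F : of G ⟶ of H) : IsPce (toFunctor F) := F.hom.property

/-- The 2-cell given by a natural transformation. -/
def ofNatTrans {F F' : of G ⟶ of H} (α : toFunctor F ⟶ toFunctor F') : F ⟶ F' :=
  ⟨⟨α⟩⟩

/-- The natural transformation underlying a 2-cell. -/
def toNatTrans {F F' : of G ⟶ of H} (α : F ⟶ F') : toFunctor F ⟶ toFunctor F' :=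
  α.hom.hom

theorem hom₂_ext {F F' : of G ⟶ of H} {α β : F ⟶ F'} (h : toNatTrans α = toNatTrans β) : α = β :=
  Bicategory.InducedBicategory.hom₂_ext (ObjectProperty.hom_ext _ h)

/-- The invertible 2-cell given by a natural isomorphism. -/
def isoOfNatIso {F F' : of G ⟶ of H} (α : toFunctor F ≅ toFunctor F') : F ≅ F' where
  hom := ofNatTrans α.hom
  inv := ofNatTrans α.inv
  hom_inv_id := hom₂_ext α.hom_inv_id
  inv_hom_id := hom₂_ext α.inv_hom_id

end CogloCat

/-! ### The pseudofunctor and the biequivalence -/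

open CogloCat GpdSpan in
/-- The pseudofunctor which sends a span to its realization. -/
def burnGloToCogloCat : Pseudofunctor BurnGlo.{u} CogloCat.{u} where
  obj G := CogloCat.of G.of
  map {G H} (S : BurnSpan G.of H.of) :=
    CogloCat.ofFunctor S.realization.functor S.realization.isPce
  map₂ {G H} (S T : BurnSpan G.of H.of) (η : S.span ⟶ T.span) :=
    ofNatTrans (lift η S.realization T.realization)
  map₂_id S := hom₂_ext (lift_id _)
  map₂_comp η θ := hom₂_ext (lift_comp η θ _ _ _)
  -- The chosen realization of the identity span need not be the identity functor; both realize the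
  -- same span, so the identity 2-cell compares them.
  mapId G := isoOfNatIso (liftIso (Iso.refl (GpdSpan.identity G.of))
    (BurnSpan.identity G.of).realization (Realization.id G.of))
  mapComp {G H M} (S : BurnSpan G.of H.of) (T : BurnSpan H.of M.of) :=
    isoOfNatIso (liftIso (BurnSpan.compIso S T) (S.comp T).realization
      (Realization.comp S.realization T.realization))
  map₂_whisker_left {G H M} (S : BurnSpan G.of H.of) (T T' : BurnSpan H.of M.of) η :=
    hom₂_ext (lift_conj_whiskerLeft (S.compIso T).hom η (S.compIso T').inv _ _ _ _ _)
  map₂_whisker_right {G H M} (S S' : BurnSpan G.of H.of) η (T : BurnSpan H.of M.of) :=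
    hom₂_ext (lift_conj_whiskerRight (S.compIso T).hom η (S'.compIso T).inv _ _ _ _ _)
  map₂_associator {G H M N} (S : BurnSpan G.of H.of) (T : BurnSpan H.of M.of)
      (U : BurnSpan M.of N.of) :=
    hom₂_ext (lift_conj_associator ((S.comp T).compIso U).hom (S.compIso T).hom
      (T.compIso U).inv (S.compIso (T.comp U)).inv _ _ _ _ _ _ _)
  map₂_left_unitor {G H} (S : BurnSpan G.of H.of) :=
    hom₂_ext (lift_conj_leftUnitor ((BurnSpan.identity G.of).compIso S).hom (𝟙 _) _ _ _)
  map₂_right_unitor {G H} (S : BurnSpan G.of H.of) :=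
    hom₂_ext (lift_conj_rightUnitor (S.compIso (BurnSpan.identity H.of)).hom (𝟙 _) _ _ _)

theorem burnGloToCogloCat_isBiequivalence : IsBiequivalence burnGloToCogloCat.{u} := by
  refine ⟨?_, fun G H => ?_⟩
  · rintro ⟨_, G, rfl⟩
    exact ⟨⟨G⟩, ⟨Bicategory.Equivalence.id _⟩⟩
  · exact
      { faithful := ⟨fun {S T η θ} h => GpdSpan.lift_injective (BurnSpan.isDiscreteFibration T) _ _
          (congrArg CogloCat.toNatTrans h)⟩
        full := ⟨fun {S T} α => by
          obtain ⟨η, h⟩ := GpdSpan.lift_surjective (BurnSpan.isDiscreteFibration T)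
            (R := BurnSpan.realization S) (R' := BurnSpan.realization T) (CogloCat.toNatTrans α)
          exact ⟨η, CogloCat.hom₂_ext h⟩⟩
        essSurj := ⟨fun F => by
          -- The functor and the chosen realization of its span of members realize the same span,
          -- hence are isomorphic.
          let S := BurnSpan.ofFunctor (CogloCat.toFunctor F)
          let R : S.span.Realization := Realization.ofIsPce (CogloCat.toFunctor_isPce F)
          exact ⟨S, ⟨CogloCat.isoOfNatIso
            (GpdSpan.liftIso (Iso.refl S.span) S.realization R)⟩⟩⟩ }

/-! ### Passage to invertible 2-cells -/

section Pith

open Bicategory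

universe w₁ w₂ v₁ v₂ u₁ u₂

variable {B : Type u₁} [Bicategory.{w₁, v₁} B] {C : Type u₂} [Bicategory.{w₂, v₂} C]

/-- The pseudofunctor induced on (2,1)-categories of invertible 2-cells. -/
def pithMap (F : Pseudofunctor B C) : Pseudofunctor (Pith B) (Pith C) :=
  Pith.pseudofunctorToPith ((Pith.inclusion B).comp F)

/-- Equivalences in a 2-category only involve invertible 2-cells. -/
def pithEquivalence {a b : C} (e : Bicategory.Equivalence a b) :
    Bicategory.Equivalence (Pith.mk a) (Pith.mk b) where
  hom := ⟨e.hom⟩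
  inv := ⟨e.inv⟩
  unit := Core.isoMk e.unit
  counit := Core.isoMk e.counit
  left_triangle := by
    ext
    exact e.left_triangle_hom

/-- An equivalence of categories restricts to an equivalence of cores, since isomorphisms lift along
fully faithful functors and essential surjectivity only mentions isomorphisms. -/
theorem IsBiequivalence.pithMap {F : Pseudofunctor B C} (hF : IsBiequivalence F) :
    IsBiequivalence (pithMap F) := by
  refine ⟨fun c => ?_, fun a b => ?_⟩
  · obtain ⟨b, ⟨e⟩⟩ := hF.1 c.as
    exact ⟨⟨b⟩, ⟨pithEquivalence e⟩⟩
  · have := hF.2 a.as b.as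
    exact
      { faithful := ⟨fun {f g η θ} h => Pith.hom₂_ext _ ((F.mapFunctor a.as b.as).map_injective
          (congrArg (fun k => k.iso.hom) h))⟩
        full := ⟨fun {f g} α => ⟨⟨(F.mapFunctor a.as b.as).preimageIso α.iso⟩,
          Pith.hom₂_ext _ ((F.mapFunctor a.as b.as).map_preimage α.iso.hom)⟩⟩
        essSurj := ⟨fun f => ⟨⟨(F.mapFunctor a.as b.as).objPreimage f.of⟩,
          ⟨Core.isoMk ((F.mapFunctor a.as b.as).objObjPreimageIso f.of)⟩⟩⟩ }

end Pith

end
end GlobalBurnside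

theorem mainTheorem9 :
    (∃ F : CategoryTheory.Pseudofunctor GlobalBurnside.BurnGlo.{u} GlobalBurnside.CogloCat.{u},
      GlobalBurnside.IsBiequivalence F ∧
        ∀ G : GlobalBurnside.FinGpd.{u}, F.obj ⟨G⟩ = GlobalBurnside.CogloCat.of G) ∧
    ∃ F : CategoryTheory.Pseudofunctor
        (CategoryTheory.Bicategory.Pith GlobalBurnside.BurnGlo.{u})
        (CategoryTheory.Bicategory.Pith GlobalBurnside.CogloCat.{u}),
      GlobalBurnside.IsBiequivalence F ∧
        ∀ G : GlobalBurnside.FinGpd.{u}, F.obj ⟨⟨G⟩⟩ = ⟨GlobalBurnside.CogloCat.of G⟩ :=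
  ⟨⟨GlobalBurnside.burnGloToCogloCat, GlobalBurnside.burnGloToCogloCat_isBiequivalence,
    fun _ => rfl⟩,
    ⟨GlobalBurnside.pithMap GlobalBurnside.burnGloToCogloCat,
      GlobalBurnside.burnGloToCogloCat_isBiequivalence.pithMap, fun _ => rfl⟩⟩
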